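/- Let $\mathcal A$ be an AB5 abelian category (cocomplete, with exact filtered colimits), let $\mathcal X\subseteq\mathcal A$ be a class of objects and let $Q$ be a left-rooted quiver, i.e. a (small) quiver with no infinite sequence of composable arrows $\cdots\to\bullet\to\bullet\to\bullet$. Classes of objects are understood up to isomorphism. Let $\mathrm{Rep}(Q,\mathcal A)$ be the category of functors from the path category of $Q$ to $\mathcal A$. For a vertex $v$ let $f_v:\mathcal A\to\mathrm{Rep}(Q,\mathcal A)$, $f_v(X)(w)=\bigoplus_{v\leadsto w}X$ (sum over all paths from $v$ to $w$), be the left adjoint of evaluation at $v$, and put $f_*(\mathcal X)=\{f_v(X)\mid v\in Q_0,\ X\in\mathcal X\}$. Let $\Phi(\mathcal X)$ be the class of all $F\in\mathrm{Rep}(Q,\mathcal A)$ such that for every vertex $v$ the canonical map $\bigoplus_{w\to v}F(w)\to F(v)$ (sum over all arrows with target $v$) is a monomorphism with cokernel in $\mathcal X$. For a class $\mathcal Y$ of objects of an abelian category, $\bigoplus\mathcal Y$ is the class of all small direct sums of objects of $\mathcal Y$. An object $Y$ is $\mathcal Y$-filtered, $Y\in\mathrm{Filt}\,\mathcal Y$,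 if for some ordinal $\lambda$ there is a chain of subobjects $0=Y_0\subseteq\dots\subseteq Y_\lambda=Y$ with $Y_{\alpha+1}/Y_\alpha\in\mathcal Y$ for all $\alpha<\lambda$ and $Y_{\beta}=\varinjlim_{\alpha<\beta}Y_\alpha$ for all limit ordinals $\beta\le\lambda$. The class $\mathrm{ext}\,\mathcal Y$ consists of the objects with such a filtration of finite length $\lambda$, $\mathrm{sFilt}\,\mathcal Y$ consists of all direct summands of $\mathcal Y$-filtered objects, and $\varinjlim\mathcal Y$ of all colimits of small filtered systems of objects of $\mathcal Y$. Finally $FP_{2.5}(\mathcal A)$ is the class of all $X\in\mathcal A$ for which the canonical map $\varinjlim\mathrm{Ext}^k(X,Y_i)\to\mathrm{Ext}^k(X,\varinjlim Y_i)$ is, for every small filtered system $(Y_i)$ in $\mathcal A$, an isomorphism for $k=0,1$ and a monomorphism for $k=2$. Then: (i) Every $F\in\Phi(\mathcal X)$ is $\bigoplus f_*(\mathcal X)$-filtered. (ii) If $\mathcal X$ is closed under filtrations (i.e. $\mathrm{Filt}\,\mathcal X\subseteq\mathcal X$), then $\Phi(\mathcal X)=\mathrm{Filt}\bigoplus f_*(\mathcal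 X)$. (iii) If $\mathcal X$ is a set, then $\Phi(\mathrm{Filt}\,\mathcal X)=\mathrm{Filt}\,f_*(\mathcal X)\supseteq\mathrm{Filt}\,\Phi(\mathcal X)$, and if moreover $0\in\mathcal X$, then $\mathrm{Filt}\,f_*(\mathcal X)=\mathrm{Filt}\,\Phi(\mathcal X)$. (iv) If $\mathcal X$ is a set, then $\Phi(\mathrm{sFilt}\,\mathcal X)=\mathrm{sFilt}\,f_*(\mathcal X)=\mathrm{sFilt}\,\Phi(\mathcal X)$. (v) If $\mathcal A$ is locally finitely presented and $\mathcal X\subseteq FP_{2.5}(\mathcal A)$, then $\varinjlim\Phi(\mathcal X)\subseteq\Phi(\varinjlim\mathcal X)\subseteq\varinjlim\mathrm{ext}\,f_*(\mathcal X)$, and if moreover $0\in\mathcal X$ and $\mathcal X$ is closed under extensions, then $\Phi(\varinjlim\mathcal X)=\varinjlim\mathrm{ext}\,f_*(\mathcal X)=\varinjlim\Phi(\mathcal X)$. -/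

import Mathlib

open CategoryTheory CategoryTheory.Limits

universe v u

noncomputable section

namespace QuiverRep

section Closures

variable {C : Type u} [Category.{v} C]

/-- The class `⨁ P` of all (possibly infinite, possibly empty) small coproducts of families of
objects of `P`. -/
def sums (P : ObjectProperty C) : ObjectProperty C := fun M =>
  ∃ I : Type v, P.colimitsOfShape (Discrete I) M

/-- The class `lim P` of all colimits of small filtered systems of objects of `P`. -/
def dirLim (P : ObjectProperty C) : ObjectProperty C := ObjectProperty.ind.{v} P

variable [Abelian C]

/-- `M` has a `P`-filtration indexed by the well-ordered set `J` with least element `⊥` and largest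
element `⊤` (so `J` is the set of all ordinals `α ≤ lam` for some ordinal `lam`): a chain of
subobjects, starting at zero and ending at `M`, with all successive quotients in `P` (up to
isomorphism, as quotients are only defined up to isomorphism), and which at every limit stage is
the colimit of the earlier stages. -/
def HasFiltrationOfShape (P : ObjectProperty C) (J : Type v) [LinearOrder J] [OrderBot J]
    [OrderTop J] [SuccOrder J] (M : C) : Prop :=
  ∃ F : J ⥤ C,
    (∀ (i j : J) (h : i ≤ j), Mono (F.map (homOfLE h))) ∧
    IsZero (F.obj ⊥) ∧
    F.IsWellOrderContinuous ∧
    (∀ j : J, ¬ IsMax j → P.isoClosure (cokernel (F.map (homOfLE (Order.le_succ j))))) ∧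
    Nonempty (F.obj ⊤ ≅ M)

/-- The class `Filt P` of all `P`-filtered objects. -/
def Filt (P : ObjectProperty C) : ObjectProperty C := fun M =>
  ∃ (J : Type v) (_ : LinearOrder J) (_ : OrderBot J) (_ : OrderTop J) (_ : SuccOrder J)
    (_ : WellFoundedLT J), HasFiltrationOfShape P J M

/-- The class `sFilt P` of all direct summands of `P`-filtered objects. -/
def sFilt (P : ObjectProperty C) : ObjectProperty C := fun M =>
  ∃ N : C, Filt P (M ⊞ N)

/-- The class `ext P` of all finite extensions of objects of `P`, i.e. of the objects with a
`P`-filtration of finite length. -/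
def finExt (P : ObjectProperty C) : ObjectProperty C := fun M =>
  ∃ (J : Type v) (_ : LinearOrder J) (_ : OrderBot J) (_ : OrderTop J) (_ : SuccOrder J)
    (_ : Finite J), HasFiltrationOfShape P J M

end Closures

section Finiteness

variable {C : Type u} [Category.{v} C] [Abelian C] [HasColimits C]

/-- The canonical map `colim_j Ext^k(X, Y_j) ⟶ Ext^k(X, colim_j Y_j)`. The `Ext`-groups are
the Yoneda (derived category) ones, which exist in every abelian category, in a possibly larger
universe. -/
def extComparison (X : C) (k : ℕ) {J : Type v} [SmallCategory J] (Y : J ⥤ C) :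
    letI := HasExt.standard C
    colimit (Y ⋙ Abelian.extFunctorObj X k) ⟶ (Abelian.extFunctorObj X k).obj (colimit Y) :=
  letI := HasExt.standard C
  colimit.post Y (Abelian.extFunctorObj X k)

/-- `X` is `FP_n`: for all `k < n`, `Ext^k(X, -)` commutes with small filtered colimits
(used for `n ≥ 1`). -/
def FP (n : ℕ) : ObjectProperty C := fun X =>
  ∀ (J : Type v) [SmallCategory J] [IsFiltered J] (Y : J ⥤ C),
    ∀ k < n, IsIso (extComparison X k Y)

/-- `X` is `FP_{n.5}`: it is `FP_n` and the canonical map is moreover a monomorphism for `k = n`. -/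
def FPHalf (n : ℕ) : ObjectProperty C := fun X =>
  FP n X ∧ ∀ (J : Type v) [SmallCategory J] [IsFiltered J] (Y : J ⥤ C), Mono (extComparison X n Y)

end Finiteness

section Representations

/-- A quiver is left-rooted if it has no infinite sequence of composable arrows
`⋯ ⟶ x 2 ⟶ x 1 ⟶ x 0`. -/
def IsLeftRooted (Q : Type v) [Quiver.{v} Q] : Prop :=
  ∀ x : ℕ → Q, IsEmpty (∀ n : ℕ, x (n + 1) ⟶ x n)

/-- `Rep(Q, A)`: functors from the path category of `Q` to `A`. -/
abbrev Rep (Q : Type v) [Quiver.{v} Q] (A : Type u) [Category.{v} A] := Paths Q ⥤ A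

variable {Q : Type v} [Quiver.{v} Q] {A : Type u} [Category.{v} A] [HasColimits A]

/-- The left adjoint `f_v : A ⥤ Rep(Q, A)` of the evaluation at the vertex `x`, that is
`f_x(X)(w) = ∐_{paths x ⇝ w} X`. -/
def freeAt (x : Q) : A ⥤ Rep Q A := evaluationLeftAdjoint A ((Paths.of Q).obj x)

/-- The class `f_*(P)` of all representations (isomorphic to) `f_x(X)` with `x` a vertex and
`X` in `P`. -/
def fStar (P : ObjectProperty A) : ObjectProperty (Rep Q A) := fun F =>
  ∃ (x : Q) (X : A), P X ∧ Nonempty (F ≅ (freeAt x).obj X)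

/-- The canonical map `φ_x^F : ∐_{a : w ⟶ x} F(w) ⟶ F(x)`, the coproduct being over all arrows
with target `x`. -/
def phi (F : Rep Q A) (x : Q) :
    (∐ fun a : (Σ w : Q, w ⟶ x) => F.obj ((Paths.of Q).obj a.1)) ⟶ F.obj ((Paths.of Q).obj x) :=
  Sigma.desc fun a => F.map ((Paths.of Q).map a.2)

variable [Abelian A]

/-- The class `Φ(P)` of all representations `F` such that for every vertex `x` the map `φ_x^F` is
a monomorphism with cokernel in `P` (up to isomorphism). -/
def Phi (P : ObjectProperty A) : ObjectProperty (Rep Q A) := fun F =>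
  ∀ x : Q, Mono (phi F x) ∧ P.isoClosure (cokernel (phi F x))

end Representations

end QuiverRep

end

/-! Write `c_x(F)` for the cokernel of `φ_x^F` (the functor `cok x`). Left-rootedness makes the
arrow relation well-founded, so the vertices have a well-order extending it. If all `φ_x^F` are
monomorphisms, let `F_S` be the subrepresentation generated by the `F(x)` with `x ∈ S`, and add
vertices one at a time. The quotient `K` of `F_{≤ v}` by `F_{< v}` vanishes at the vertices before
`v`, has `c_w(K) = 0` for `w ≠ v`, and `c_v(K) = c_v(F)`; a snake argument shows that every `φ_x^K`
is mono. A map into such a representation is an isomorphism as soon as all the `c_x` of it are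
(`isIso_of_isIso_cok_map`), so `K ≅ f_v(c_v(F))` (`exists_iso_layer`). Hence objects of `Φ(X)` are
already `f_*(X)`-filtered, with no direct sums in the layers (`phi_le_filt`).

Conversely `c_x` preserves colimits, and keeps an inclusion mono when the quotient has mono `φ_x`.
It thus carries filtrations by objects of `Φ(X)` to `X`-filtrations (`filt_phi_le`). The equalities
for `Filt` and `sFilt` follow from these two inclusions, from `Filt` being idempotent, and from
`f_x` being an exact left adjoint.

For direct limits, `FP_2` is rephrased through short exact sequences (`FPTwo`). In that form it
passes along `f_x`, it makes finite extensions of objects `f_x(X)` finitely presentable, and it lets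
extensions of direct limits be written as direct limits of extensions (`dirLim_of_shortExact`).
Transfinite induction along the filtration of an object of `Φ(lim X)` then puts it in `lim ext
f_*(X)`.

Filtrations are handled as `Stages`: all "union" conditions are tested against arbitrary subobjects
`N` of `M`, which spares separate treatment of limit stages when filtrations are combined. -/

noncomputable section

namespace QuiverRep

attribute [-instance] catToReflQuiver

/-! ### Filtrations recorded step by step. -/

section Stages

universe w u'

variable {C : Type u} [Category.{v} C]

/-- `f` factors through `g`. -/
def Fac {X Y M : C} (f : X ⟶ M) (g : Y ⟶ M) : Prop := ∃ k : X ⟶ Y, k ≫ g = f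

lemma Fac.trans {X Y Z M : C} {f : X ⟶ M} {g : Y ⟶ M} {h : Z ⟶ M} (h₁ : Fac f g) (h₂ : Fac g h) :
    Fac f h := by
  obtain ⟨k, rfl⟩ := h₁
  obtain ⟨l, rfl⟩ := h₂
  exact ⟨k ≫ l, by simp⟩

lemma Fac.refl {X M : C} (f : X ⟶ M) : Fac f f := ⟨𝟙 _, by simp⟩

lemma Fac.comp_left {X X' Y M : C} {f : X ⟶ M} {g : Y ⟶ M} (h : Fac f g) (k : X' ⟶ X) :
    Fac (k ≫ f) g := by
  obtain ⟨l, rfl⟩ := h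
  exact ⟨k ≫ l, by simp⟩

/-- Transition maps between subobjects are unique, hence functorial. The result is stated up to
mutual factorization so that the objects of `F` never need to be unfolded. -/
lemma exists_chain {J : Type w} [Preorder J] {M : C} (A : J → C) (α : ∀ j, A j ⟶ M)
    (hα : ∀ j, Mono (α j)) (h : ∀ i j, i ≤ j → Fac (α i) (α j)) :
    ∃ (F : J ⥤ C) (γ : ∀ j, F.obj j ⟶ M), (∀ j, Mono (γ j)) ∧
      (∀ (i j : J) (f : i ⟶ j), F.map f ≫ γ j = γ i) ∧ ∀ j, Fac (γ j) (α j) ∧ Fac (α j) (γ j) := by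
  choose k hk using h
  refine ⟨{
    obj := A
    map f := k _ _ (leOfHom f)
    map_id j := by rw [← cancel_mono (α j), hk]; simp
    map_comp {i j l} f g := by
      rw [← cancel_mono (α l), hk, Category.assoc, hk, hk] }, α, hα, fun i j f ↦ hk _ _ _,
    fun j ↦ ⟨.refl _, .refl _⟩⟩

lemma isIso_of_fac_id {N M : C} (n : N ⟶ M) [Mono n] (h : Fac (𝟙 M) n) : IsIso n := by
  obtain ⟨k, hk⟩ := h
  exact ⟨k, by rw [← cancel_mono n]; simp [hk], hk⟩

/-- By exactness of filtered colimits the comparison map from the colimit to `c.pt` is mono (compare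
`D` with a constant diagram, whose colimit is its value since `J` is connected). It contains every
stage, so the hypothesis applies to it. -/
lemma isColimit_of_forall_fac [Abelian C] {J : Type w} [SmallCategory J] [IsFiltered J]
    [HasColimitsOfShape J C] [HasExactColimitsOfShape J C]
    {D : J ⥤ C} (c : Cocone D) (hc : ∀ j, Mono (c.ι.app j))
    (h : ∀ ⦃N : C⦄ (n : N ⟶ c.pt) [Mono n], (∀ j, Fac (c.ι.app j) n) → IsIso n) :
    Nonempty (IsColimit c) := by
  have := NatTrans.mono_of_mono_app c.ι
  let d : colimit D ⟶ c.pt := colimit.desc D c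
  have hd (j) : colimit.ι D j ≫ d = c.ι.app j := colimit.ι_desc _ _
  have : IsConnected J := IsFiltered.isConnected J
  have : Mono d := colim.map_mono' c.ι (colimit.isColimit _) (isColimitConstCocone J c.pt) d
    (fun j ↦ by
      simp only [constCocone]
      simpa using hd j)
  have : IsIso d := h d (fun j ↦ ⟨_, hd j⟩)
  exact ⟨IsColimit.ofPointIso (colimit.isColimit D) (t := c) (i := this)⟩

lemma hasFiltrationOfShape_of_chain [Abelian C] [HasColimits C] [AB5 C] {P : ObjectProperty C}
    {J : Type v} [LinearOrder J] [OrderBot J] [OrderTop J] [SuccOrder J] {M : C} (F : J ⥤ C)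
    (γ : ∀ j, F.obj j ⟶ M) [hm : ∀ j, Mono (γ j)]
    (hγ : ∀ (i j : J) (f : i ⟶ j), F.map f ≫ γ j = γ i)
    (bot : γ ⊥ = 0) (top : Fac (𝟙 M) (γ ⊤))
    (sup : ∀ m, Order.IsSuccLimit m → ∀ ⦃N : C⦄ (n : N ⟶ M) [Mono n], (∀ j < m, Fac (γ j) n) →
      Fac (γ m) n)
    (layer : ∀ j : J, ¬ IsMax j → P.isoClosure (cokernel (F.map (homOfLE (Order.le_succ j))))) :
    HasFiltrationOfShape P J M := by
  have hF {i j : J} (f : i ⟶ j) : Mono (F.map f) := mono_of_mono_fac (hγ _ _ f)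
  refine ⟨F, fun i j h ↦ inferInstance, IsZero.of_mono_eq_zero _ bot, ⟨fun m hm ↦ ?_⟩, layer, ?_⟩
  · have : Nonempty (Set.Iio m) := ⟨⟨⊥, hm.bot_lt⟩⟩
    have key ⦃N : C⦄ (n : N ⟶ F.obj m) [Mono n]
        (h : ∀ (j : J) (hj : j < m), Fac (F.map (homOfLE hj.le)) n) : IsIso n := by
      obtain ⟨k, hk⟩ : Fac (γ m) (n ≫ γ m) := sup m hm _ (fun j hj ↦ by
        obtain ⟨k, hk⟩ := h j hj
        exact ⟨k, by rw [reassoc_of% hk, hγ]⟩)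
      exact isIso_of_fac_id _ ⟨k, by rw [← cancel_mono (γ m)]; simpa using hk⟩
    exact isColimit_of_forall_fac _ (fun j ↦ hF (homOfLE (Set.mem_Iio.1 j.2).le))
      (fun N n hn h ↦ @key N n hn (fun j hj ↦ h ⟨j, hj⟩))
  · have := isIso_of_fac_id _ top
    exact ⟨asIso (γ ⊤)⟩

variable [Abelian C]

/-- A filtration of `M` indexed by its steps: the `i`-th step enlarges the subobject `A i` to `B i`,
with quotient `X i`. -/
structure Stages (M : C) {I : Type w} [LinearOrder I] (X : I → C) where
  A : I → C
  B : I → C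
  α : ∀ i, A i ⟶ M
  β : ∀ i, B i ⟶ M
  mono_α : ∀ i, Mono (α i) := by infer_instance
  mono_β : ∀ i, Mono (β i) := by infer_instance
  ι : ∀ i, A i ⟶ B i
  π : ∀ i, B i ⟶ X i
  ι_β : ∀ i, ι i ≫ β i = α i
  zero : ∀ i, ι i ≫ π i = 0
  exact : ∀ i, (ShortComplex.mk (ι i) (π i) (zero i)).ShortExact
  fac : ∀ i j, i < j → Fac (β i) (α j)
  -- `A i` is the union of the earlier `B j`. For the least `i` the condition is vacuous and forces
  -- `α i = 0`.
  sup : ∀ i ⦃N : C⦄ (n : N ⟶ M) [Mono n], (∀ j < i, Fac (β j) n) → Fac (α i) n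
  top : ∀ ⦃N : C⦄ (n : N ⟶ M) [Mono n], (∀ j, Fac (β j) n) → IsIso n

attribute [instance] Stages.mono_α Stages.mono_β

namespace Stages

variable {M : C} {I : Type w} [LinearOrder I] {X : I → C}

section

variable (s : Stages M X)

lemma fac_αβ (i : I) : Fac (s.α i) (s.β i) := ⟨_, s.ι_β i⟩

lemma fac_ββ {i j : I} (h : i ≤ j) : Fac (s.β i) (s.β j) := by
  obtain rfl | h := h.eq_or_lt
  · exact .refl _
  · exact (s.fac i j h).trans (s.fac_αβ j)

lemma fac_αα {i j : I} (h : i ≤ j) : Fac (s.α i) (s.α j) := by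
  obtain rfl | h := h.eq_or_lt
  · exact .refl _
  · exact (s.fac_αβ i).trans (s.fac i j h)

end

/-- Replaces the layers by isomorphic objects. -/
def ofIso (s : Stages M X) {X' : I → C} (e : ∀ i, X i ≅ X' i) : Stages M X' where
  A := s.A
  B := s.B
  α := s.α
  β := s.β
  mono_α := s.mono_α
  mono_β := s.mono_β
  ι := s.ι
  π i := s.π i ≫ (e i).hom
  ι_β := s.ι_β
  zero i := by rw [← Category.assoc, s.zero, zero_comp]
  exact i := ShortComplex.shortExact_of_iso
    (ShortComplex.isoMk (S₁ := ShortComplex.mk _ _ (s.zero i)) (Iso.refl _) (Iso.refl _) (e i)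
      (by simp) (by simp)) (s.exact i)
  fac := s.fac
  sup := s.sup
  top := s.top

section ToFilt

/-- Steps correspond to the non-maximal elements of `WithTop I`: stage `i` is `A i`, stage `⊤` is
`M`, and the successor of `i` is identified with `B i`, since both are the union of the `B k` with
`k ≤ i`. -/
lemma hasFiltrationOfShape {M : C} {I : Type v} [LinearOrder I] {X : I → C} [WellFoundedLT I]
    [HasColimits C] [AB5 C] (s : Stages M X) [OrderBot (WithTop I)] [SuccOrder (WithTop I)]
    {P : ObjectProperty C} (hX : ∀ i, P (X i)) : HasFiltrationOfShape P (WithTop I) M := by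
  let A : WithTop I → C := WithTop.recTopCoe M s.A
  let α : ∀ j : WithTop I, A j ⟶ M := WithTop.recTopCoe (C := fun j ↦ A j ⟶ M) (𝟙 M) s.α
  have hα (j : WithTop I) : Mono (α j) := by
    induction j with
    | top => exact inferInstanceAs (Mono (𝟙 M))
    | coe i => exact s.mono_α i
  have fac_αα (i j : WithTop I) (h : i ≤ j) : Fac (α i) (α j) := by
    induction j with
    | top => exact ⟨α i, Category.comp_id _⟩
    | coe j =>
      induction i with
      | top => simp at h
      | coe i => exact s.fac_αα (by simpa using h)
  have fac_α (j : WithTop I) {N : C} (n : N ⟶ M) [Mono n]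
      (h : ∀ i : I, (i : WithTop I) < j → Fac (s.β i) n) : Fac (α j) n := by
    induction j with
    | top =>
      have := s.top n (fun i ↦ h i (WithTop.coe_lt_top i))
      exact ⟨(inv n : M ⟶ N), IsIso.inv_hom_id n⟩
    | coe j => exact s.sup j n (fun i hi ↦ h i (by simpa using hi))
  have fac_βα (i : I) (j : WithTop I) (h : (i : WithTop I) < j) : Fac (s.β i) (α j) := by
    induction j with
    | top => exact ⟨s.β i, Category.comp_id _⟩
    | coe j => exact s.fac i j (by simpa using h)
  have fac_coe (i : I) : Fac (α i) (s.α i) ∧ Fac (s.α i) (α i) := ⟨.refl _, .refl _⟩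
  have top_fac : Fac (𝟙 M) (α ⊤) := .refl _
  clear_value α A
  obtain ⟨F, γ, hm, hγ, h⟩ := exists_chain A α hα fac_αα
  refine hasFiltrationOfShape_of_chain F γ hγ ?_ (top_fac.trans (h _).2) ?_ ?_
  -- No step lies below `⊥`, so the bottom stage lies in the zero subobject.
  · obtain ⟨k, hk⟩ := (h ⊥).1.trans (fac_α ⊥ (0 : ⊥_ C ⟶ M) (fun i hi ↦ by simp at hi))
    rw [← hk, comp_zero]
  · intro m hm N n _ hn
    refine (h m).1.trans (fac_α m n (fun i hi ↦ ?_))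
    obtain ⟨j, hjm, hj⟩ := (hm.lt_iff_exists_lt).1 hi
    exact (fac_βα i j hj).trans ((h j).2.trans (hn j hjm))
  · intro j hj
    induction j with
    | top => exact (hj isMax_top).elim
    | coe i =>
      obtain ⟨a, ha⟩ : Fac (s.β i) (γ (Order.succ (i : WithTop I))) :=
        (fac_βα _ _ (Order.lt_succ_of_not_isMax hj)).trans (h _).2
      obtain ⟨b, hb⟩ : Fac (γ (Order.succ (i : WithTop I))) (s.β i) :=
        (h _).1.trans (fac_α _ _ (fun k hk ↦ s.fac_ββ (by simpa using Order.le_of_lt_succ hk)))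
      obtain ⟨c, hc⟩ : Fac (s.α i) (γ i) := (fac_coe i).2.trans (h _).2
      obtain ⟨d, hd⟩ : Fac (γ i) (s.α i) := (h _).1.trans (fac_coe i).1
      let e : s.B i ≅ F.obj (Order.succ (i : WithTop I)) :=
        ⟨a, b, by rw [← cancel_mono (s.β i)]; simp [hb, ha],
          by rw [← cancel_mono (γ _)]; simp [hb, ha]⟩
      let e' : s.A i ≅ F.obj i :=
        ⟨c, d, by rw [← cancel_mono (s.α i)]; simp [hc, hd],
          by rw [← cancel_mono (γ _)]; simp [hc, hd]⟩
      refine ⟨X i, hX i, ⟨cokernel.mapIso _ (s.ι i) e'.symm e.symm ?_ ≪≫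
        IsColimit.coconePointUniqueUpToIso (colimit.isColimit _) (s.exact i).gIsCokernel⟩⟩
      rw [← cancel_mono (s.β i)]
      simp [e, e', hb, hd, s.ι_β, hγ]

lemma filt {M : C} {I : Type v} [LinearOrder I] {X : I → C} [WellFoundedLT I]
    [HasColimits C] [AB5 C] (s : Stages M X) {P : ObjectProperty C} (hX : ∀ i, P (X i)) :
    Filt P M := by
  let : OrderBot (WithTop I) := WellFoundedLT.toOrderBot _
  let : SuccOrder (WithTop I) := SuccOrder.ofLinearWellFoundedLT _
  exact ⟨WithTop I, inferInstance, inferInstance, inferInstance, inferInstance, inferInstance,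
    s.hasFiltrationOfShape hX⟩

lemma finExt {M : C} {I : Type v} [LinearOrder I] {X : I → C} [Finite I]
    [HasColimits C] [AB5 C] (s : Stages M X) {P : ObjectProperty C} (hX : ∀ i, P (X i)) :
    finExt P M := by
  let : OrderBot (WithTop I) := WellFoundedLT.toOrderBot _
  let : SuccOrder (WithTop I) := SuccOrder.ofLinearWellFoundedLT _
  exact ⟨WithTop I, inferInstance, inferInstance, inferInstance, inferInstance, inferInstance,
    s.hasFiltrationOfShape hX⟩

end ToFilt

end Stages

end Stages

end QuiverRep

end

/-! ### Refining a filtration by filtrations of its layers. -/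

noncomputable section

namespace QuiverRep

attribute [-instance] catToReflQuiver

attribute [local simp] pullback.lift_fst pullback.lift_fst_assoc pullback.lift_snd
  pullback.lift_snd_assoc pushout.inl_desc pushout.inl_desc_assoc pushout.inr_desc
  pushout.inr_desc_assoc

section Abelian

variable {C : Type u} [Category.{v} C] [Abelian C]

lemma shortExact_of_fac {X Y Z : C} (f : X ⟶ Y) (g : Y ⟶ Z) (w : f ≫ g = 0) [Mono f] [Epi g]
    (h : ∀ ⦃T : C⦄ (x : T ⟶ Y), x ≫ g = 0 → Fac x f) : (ShortComplex.mk f g w).ShortExact where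
  exact := by
    rw [ShortComplex.exact_iff_exact_up_to_refinements]
    intro T x hx
    obtain ⟨k, hk⟩ := h x hx
    exact ⟨T, 𝟙 T, inferInstance, k, by simpa using hk.symm⟩
  mono_f := inferInstance
  epi_g := inferInstance

lemma fac_of_shortExact {X Y Z : C} {f : X ⟶ Y} {g : Y ⟶ Z} {w : f ≫ g = 0}
    (h : (ShortComplex.mk f g w).ShortExact) {T : C} (x : T ⟶ Y) (hx : x ≫ g = 0) : Fac x f := by
  have := h.mono_f
  exact ⟨h.exact.lift x hx, h.exact.lift_f x hx⟩

/-- In an abelian category epimorphisms are strong, so they lift against `n`. This permits testing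
containment on a cover. -/
lemma Fac.of_epi {T T' N M : C} {x : T ⟶ M} {n : N ⟶ M} [Mono n] (e : T' ⟶ T) [Epi e]
    (h : Fac (e ≫ x) n) : Fac x n := by
  obtain ⟨k, hk⟩ := h
  have := strongEpi_of_epi e
  have sq : CommSq k e n x := ⟨hk⟩
  exact ⟨sq.lift, sq.fac_right⟩

lemma Fac.add {T N M : C} {x y : T ⟶ M} {n : N ⟶ M} (hx : Fac x n) (hy : Fac y n) :
    Fac (x + y) n := by
  obtain ⟨k, rfl⟩ := hx
  obtain ⟨l, rfl⟩ := hy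
  exact ⟨k + l, by simp⟩

section

variable {A B X M N Y : C} {ι : A ⟶ B} {π : B ⟶ X} {zero : ι ≫ π = 0} (β : B ⟶ M) (n : N ⟶ M)
  (a : Y ⟶ X)

/-- An element of the preimage of `Y` in `B` agrees modulo `A`, after passing to a cover, with an
element of `N ∩ B`, and `A` lies in `N`. With the converse below, testing preimages against `N`
becomes testing subobjects of the layer against the image of `N ∩ B`. -/
lemma fac_pullback_of_fac_image [Mono n] (h : (ShortComplex.mk ι π zero).ShortExact)
    (hα : Fac (ι ≫ β) n) (ha : Fac a (image.ι (pullback.snd n β ≫ π))) :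
    Fac (pullback.fst π a ≫ β) n := by
  obtain ⟨k, hk⟩ := ha
  let r := factorThruImage (pullback.snd n β ≫ π)
  have hr : r ≫ image.ι _ = pullback.snd n β ≫ π := image.fac _
  let w₁ := pullback.fst (pullback.snd π a ≫ k) r
  let w₂ := pullback.snd (pullback.snd π a ≫ k) r
  have hw : w₁ ≫ pullback.snd π a ≫ k = w₂ ≫ r := pullback.condition
  apply Fac.of_epi w₁
  -- The two lifts have the same image in `X`, so their difference comes from `A`.
  obtain ⟨z, hz⟩ := fac_of_shortExact h (w₁ ≫ pullback.fst π a - w₂ ≫ pullback.snd n β) (by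
    have : w₁ ≫ pullback.snd π a ≫ a = w₂ ≫ pullback.snd n β ≫ π := by
      simpa [hr, hk] using congrArg (· ≫ image.ι (pullback.snd n β ≫ π)) hw
    rw [Preadditive.sub_comp, Category.assoc, Category.assoc, pullback.condition, this, sub_self])
  have : w₁ ≫ pullback.fst π a ≫ β = w₂ ≫ pullback.fst n β ≫ n + z ≫ ι ≫ β := by
    rw [pullback.condition, ← Category.assoc z, hz]
    simp
  rw [this]
  exact Fac.add ⟨w₂ ≫ pullback.fst n β, by simp⟩ (hα.comp_left z)

lemma fac_image_of_fac_pullback [Epi π] (h : Fac (pullback.fst π a ≫ β) n) :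
    Fac a (image.ι (pullback.snd n β ≫ π)) := by
  obtain ⟨k, hk⟩ := h
  apply Fac.of_epi (pullback.snd π a)
  refine ⟨pullback.lift k (pullback.fst π a) hk ≫ factorThruImage _, ?_⟩
  rw [Category.assoc, image.fac, pullback.lift_snd_assoc, pullback.condition]

end

/-- The inverse image of a short exact sequence along a quotient map. -/
lemma shortExact_pullback {B X A' B' X' : C} (π : B ⟶ X) [Epi π] {a : A' ⟶ X} {b : B' ⟶ X}
    {ι : A' ⟶ B'} {p : B' ⟶ X'} {w : ι ≫ p = 0} (h : (ShortComplex.mk ι p w).ShortExact)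
    (hι : ι ≫ b = a) :
    (ShortComplex.mk (pullback.lift (f := π) (g := b) (pullback.fst π a) (pullback.snd π a ≫ ι)
      (by rw [Category.assoc, hι, pullback.condition])) (pullback.snd π b ≫ p)
      (by rw [pullback.lift_snd_assoc, Category.assoc, w, comp_zero])).ShortExact := by
  have := h.mono_f
  have : Epi p := h.epi_g
  have : Mono (pullback.lift (f := π) (g := b) (pullback.fst π a) (pullback.snd π a ≫ ι)
      (by rw [Category.assoc, hι, pullback.condition])) := by
    refine ⟨fun x y hxy ↦ pullback.hom_ext ?_ ?_⟩
    · simpa using congrArg (· ≫ pullback.fst π b) hxy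
    · have : Mono ι := h.mono_f
      rw [← cancel_mono ι]
      simpa using congrArg (· ≫ pullback.snd π b) hxy
  refine shortExact_of_fac _ _ _ (fun T x hx ↦ ?_)
  obtain ⟨k, hk⟩ := fac_of_shortExact h (x ≫ pullback.snd π b) (by simpa using hx)
  refine ⟨pullback.lift (x ≫ pullback.fst π b) k ?_, ?_⟩
  · rw [← hι, reassoc_of% hk, Category.assoc, pullback.condition]
  · apply pullback.hom_ext <;> simp [hk]

end Abelian

instance {I : Type*} {K : I → Type*} [LinearOrder I] [∀ i, LinearOrder (K i)]
    [WellFoundedLT I] [∀ i, WellFoundedLT (K i)] : WellFoundedLT (Σₗ i, K i) where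
  wf := ⟨by
    rintro ⟨i, k⟩
    induction i using WellFoundedLT.induction with
    | ind i hi =>
    induction k using WellFoundedLT.induction with
    | ind k hk =>
    refine ⟨_, ?_⟩
    rintro _ (⟨_, _, h⟩ | ⟨_, _, h⟩)
    · exact hi _ h _
    · exact hk _ h⟩

namespace Stages

universe w w'

variable {C : Type u} [Category.{v} C] [Abelian C] {M : C} {I : Type w} [LinearOrder I]
  {X : I → C}

section Concat

variable (s : Stages M X)

instance (i : I) : Epi (s.π i) := (s.exact i).epi_g

variable [WellFoundedLT I] {K : I → Type w'} [∀ i, LinearOrder (K i)] {Y : ∀ i, K i → C}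
    (t : ∀ i, Stages (X i) (Y i))

/-- By induction `A j` lies in `N` for `j < i`. The image of `N ∩ B j` in `X j` contains all stages
of `t j`, hence is everything, so `B j` lies in `N`. -/
lemma fac_α_of_concat (i : I) {N : C} (n : N ⟶ M) [Mono n]
    (h : ∀ j < i, ∀ k, Fac (pullback.fst (s.π j) ((t j).β k) ≫ s.β j) n) : Fac (s.α i) n := by
  induction i using WellFoundedLT.induction with
  | ind i hi =>
  refine s.sup i n (fun j hj ↦ ?_)
  have := (t j).top (image.ι (pullback.snd n (s.β j) ≫ s.π j))
    (fun k ↦ fac_image_of_fac_pullback _ _ _ (h j hj k))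
  have := fac_pullback_of_fac_image (s.β j) n (𝟙 _) (s.exact j)
    (by rw [s.ι_β]; exact hi j hj (fun l hl ↦ h l (hl.trans hj)))
    ⟨inv (image.ι (pullback.snd n (s.β j) ≫ s.π j)), by simp⟩
  exact this.of_epi

lemma fac_β_of_concat (i : I) {N : C} (n : N ⟶ M) [Mono n]
    (h : ∀ j ≤ i, ∀ k, Fac (pullback.fst (s.π j) ((t j).β k) ≫ s.β j) n) : Fac (s.β i) n := by
  have := (t i).top (image.ι (pullback.snd n (s.β i) ≫ s.π i))
    (fun k ↦ fac_image_of_fac_pullback _ _ _ (h i le_rfl k))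
  have := fac_pullback_of_fac_image (s.β i) n (𝟙 _) (s.exact i)
    (by rw [s.ι_β]; exact s.fac_α_of_concat t i n (fun l hl ↦ h l hl.le))
    ⟨inv (image.ι (pullback.snd n (s.β i) ≫ s.π i)), by simp⟩
  exact this.of_epi

/-- A filtration whose layers are filtered can be refined. -/
def concat : Stages M (fun p : Σₗ i, K i ↦ Y p.1 p.2) where
  A p := pullback (s.π p.1) ((t p.1).α p.2)
  B p := pullback (s.π p.1) ((t p.1).β p.2)
  α p := pullback.fst _ _ ≫ s.β p.1
  β p := pullback.fst _ _ ≫ s.β p.1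
  mono_α p := mono_comp _ _
  mono_β p := mono_comp _ _
  ι p := pullback.lift (pullback.fst _ _) (pullback.snd _ _ ≫ (t p.1).ι p.2) (by
    rw [Category.assoc, (t p.1).ι_β, pullback.condition])
  π p := pullback.snd _ _ ≫ (t p.1).π p.2
  ι_β _ := pullback.lift_fst_assoc _ _ _ _
  zero p := by rw [pullback.lift_snd_assoc, Category.assoc, (t p.1).zero, comp_zero]
  exact p := shortExact_pullback _ ((t p.1).exact p.2) ((t p.1).ι_β p.2)
  fac := by
    rintro _ _ (⟨k, l, h⟩ | ⟨k, l, h⟩)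
    · refine Fac.comp_left ((s.fac _ _ h).trans ?_) _
      -- Across blocks: `A` of the later block maps to zero in its layer, so it lies in every
      -- preimage.
      exact ⟨pullback.lift (s.ι _) 0 (by simp [s.zero]), by simp [s.ι_β]⟩
    · obtain ⟨m, hm⟩ := (t _).fac _ _ h
      exact ⟨pullback.lift (pullback.fst _ _) (pullback.snd _ _ ≫ m)
        (by rw [Category.assoc, hm, pullback.condition]), by simp⟩
  sup := by
    rintro ⟨i, k⟩ N n _ h
    refine fac_pullback_of_fac_image _ _ _ (s.exact i) ?_ ?_
    · rw [s.ι_β]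
      exact s.fac_α_of_concat t i n (fun j hj l ↦ h ⟨j, l⟩ (Sigma.Lex.left _ _ hj))
    · refine (t i).sup k _ (fun l hl ↦ fac_image_of_fac_pullback _ _ _ ?_)
      exact h ⟨i, l⟩ (Sigma.Lex.right _ _ hl)
  top N n _ h := s.top n (fun i ↦ s.fac_β_of_concat t i n (fun j _ k ↦ h ⟨j, k⟩))

end Concat

end Stages

/-! ### From chains of subobjects to steps. -/

section OfFilt

variable {C : Type u} [Category.{v} C]

lemma exists_desc_of_isSuccLimit {J : Type v} [LinearOrder J] (F : J ⥤ C)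
    [F.IsWellOrderContinuous] {m : J} (hm : Order.IsSuccLimit m) {N : C}
    (k : ∀ j, j < m → (F.obj j ⟶ N))
    (hk : ∀ i j (hi : i < m) (hj : j < m) (f : i ⟶ j), F.map f ≫ k j hj = k i hi) :
    ∃ d : F.obj m ⟶ N, ∀ j (hj : j < m), F.map (homOfLE hj.le) ≫ d = k j hj := by
  let c : Cocone ((Set.principalSegIio m).monotone.functor ⋙ F) :=
    Cocone.mk N
      { app j := k j.1 j.2
        naturality i j f := (hk i.1 j.1 i.2 j.2 _).trans (Category.comp_id _).symm }
  exact ⟨(F.isColimitOfIsWellOrderContinuous m hm).desc c,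
    fun j hj ↦ (F.isColimitOfIsWellOrderContinuous m hm).fac c ⟨j, hj⟩⟩

lemma hom_ext_of_isSuccLimit {J : Type v} [LinearOrder J] (F : J ⥤ C)
    [F.IsWellOrderContinuous] {m : J} (hm : Order.IsSuccLimit m) {N : C}
    {f g : F.obj m ⟶ N} (h : ∀ j (hj : j < m), F.map (homOfLE hj.le) ≫ f =
      F.map (homOfLE hj.le) ≫ g) : f = g :=
  (F.isColimitOfIsWellOrderContinuous m hm).hom_ext (fun j ↦ h j.1 j.2)

variable [Abelian C]

/-- The steps are the passages from `j` to `Order.succ j`, `j` not maximal. Limit induction shows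
that a subobject containing all the successor stages up to `j` contains stage `j`. -/
lemma HasFiltrationOfShape.exists_stages {P : ObjectProperty C} {J : Type v} [LinearOrder J]
    [OrderBot J] [OrderTop J] [SuccOrder J] [WellFoundedLT J] {M : C}
    (h : HasFiltrationOfShape P J M) :
    ∃ X : {j : J // ¬ IsMax j} → C, (∀ i, P (X i)) ∧ Nonempty (Stages M X) := by
  obtain ⟨F, hF, bot, _, hP, ⟨e⟩⟩ := h
  have hF' {i j : J} (f : i ⟶ j) : Mono (F.map f) := hF i j (leOfHom f)
  choose X hX hX' using hP
  let γ (j : J) : F.obj j ⟶ M := F.map (homOfLE le_top) ≫ e.hom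
  have hγ {i j : J} (f : i ⟶ j) : F.map f ≫ γ j = γ i := by
    rw [← Category.assoc, ← Functor.map_comp]
    rfl
  have key (j : J) {N : C} (n : N ⟶ M) [Mono n]
      (h : ∀ i, ¬ IsMax i → i < j → Fac (γ (Order.succ i)) n) : Fac (γ j) n := by
    induction j using SuccOrder.limitRecOn with
    | isMin j hj =>
      obtain rfl := hj.eq_bot
      exact ⟨0, bot.eq_of_src _ _⟩
    | succ j hj _ => exact h j hj (Order.lt_succ_of_not_isMax hj)
    | isSuccLimit j hj _ =>
      have (i : J) (hi : i < j) : Fac (γ i) n := by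
        have hi' : ¬ IsMax i := fun hm ↦ hm.not_lt hi
        exact Fac.trans ⟨_, hγ (homOfLE (Order.le_succ i))⟩ (h i hi' hi)
      choose k hk using this
      obtain ⟨d, hd⟩ := exists_desc_of_isSuccLimit F hj k
        (fun i l hi hl f ↦ by rw [← cancel_mono n, Category.assoc, hk, hk, hγ])
      exact ⟨d, hom_ext_of_isSuccLimit F hj (fun i hi ↦ by rw [reassoc_of% (hd i hi), hk, hγ])⟩
  refine ⟨fun i ↦ X i.1 i.2, fun i ↦ hX _ _, ⟨{
    A i := F.obj i.1
    B i := F.obj (Order.succ i.1)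
    α i := γ _
    β i := γ _
    ι i := F.map (homOfLE (Order.le_succ i.1))
    π i := cokernel.π _ ≫ (hX' i.1 i.2).some.hom
    ι_β i := hγ _
    zero i := by simp
    exact i := ?_
    fac i j hij := ⟨F.map (homOfLE (Order.succ_le_of_lt hij)), hγ _⟩
    sup i N n _ h := key _ _ (fun j hj hji ↦ h ⟨j, hj⟩ hji)
    top N n _ h := ?_ }⟩⟩
  · refine shortExact_of_fac _ _ _ (fun T x hx ↦ ?_)
    have : x ≫ cokernel.π (F.map (homOfLE (Order.le_succ i.1))) = 0 := by
      rw [← cancel_mono (hX' i.1 i.2).some.hom]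
      simpa using hx
    exact ⟨Abelian.monoLift _ x this, Abelian.monoLift_comp _ x this⟩
  · obtain ⟨k, hk⟩ := key ⊤ n (fun i hi _ ↦ h ⟨i, hi⟩)
    exact isIso_of_fac_id n ⟨e.inv ≫ k, by simp [hk, γ]⟩

lemma Filt.exists_stages {P : ObjectProperty C} {M : C} (h : Filt P M) :
    ∃ (I : Type v) (_ : LinearOrder I) (_ : WellFoundedLT I) (X : I → C), (∀ i, P (X i)) ∧
      Nonempty (Stages M X) := by
  obtain ⟨J, _, _, _, _, _, h⟩ := h
  obtain ⟨X, hX, hs⟩ := h.exists_stages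
  exact ⟨_, inferInstance, inferInstance, X, hX, hs⟩

lemma finExt.exists_stages {P : ObjectProperty C} {M : C} (h : finExt P M) :
    ∃ (I : Type v) (_ : LinearOrder I) (_ : Finite I) (X : I → C), (∀ i, P (X i)) ∧
      Nonempty (Stages M X) := by
  obtain ⟨J, _, _, _, _, _, h⟩ := h
  obtain ⟨X, hX, hs⟩ := h.exists_stages
  exact ⟨_, inferInstance, inferInstance, X, hX, hs⟩

end OfFilt

end QuiverRep

end

/-! ### Constructions of filtrations. -/

noncomputable section

namespace QuiverRep

attribute [-instance] catToReflQuiver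

namespace Stages

universe w u' v'

variable {C : Type u} [Category.{v} C] [Abelian C] {M : C} {I : Type w} [LinearOrder I]
  {X : I → C}

/-- The image of a filtration under an exact left adjoint. -/
def map {D : Type u'} [Category.{v'} D] [Abelian D] (s : Stages M X) (L : C ⥤ D) {R : D ⥤ C}
    (adj : L ⊣ R) [PreservesFiniteLimits L] : Stages (L.obj M) (fun i ↦ L.obj (X i)) :=
  have hL : PreservesColimitsOfSize.{0, 0} L := adj.leftAdjoint_preservesColimits
  have hZ : L.PreservesZeroMorphisms := inferInstance
  -- The adjunction turns a test subobject of `L.obj M` into one of `M`, the preimage of `R.map n`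
  -- under the unit, so `sup` and `top` transfer directly.
  have key {N : D} (n : N ⟶ L.obj M) [Mono n] {Y : C} (f : Y ⟶ M) :
      Fac (L.map f) n ↔ Fac f (pullback.fst (adj.unit.app M) (R.map n)) := by
    constructor
    · rintro ⟨k, hk⟩
      exact ⟨pullback.lift f (adj.homEquiv _ _ k) (by
        rw [adj.homEquiv_unit, Category.assoc, ← R.map_comp, hk]
        exact adj.unit.naturality f), pullback.lift_fst _ _ _⟩
    · rintro ⟨k, hk⟩
      refine ⟨(adj.homEquiv _ _).symm (k ≫ pullback.snd _ _), ?_⟩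
      rw [← adj.homEquiv_naturality_right_symm, Category.assoc, ← pullback.condition, ← hk,
        Equiv.symm_apply_eq, adj.homEquiv_unit, ← Category.assoc]
      exact adj.unit.naturality _
  have hmono {N : D} (n : N ⟶ L.obj M) [Mono n] :
      Mono (pullback.fst (adj.unit.app M) (R.map n)) := by
    have : PreservesLimitsOfSize.{0, 0} R := adj.rightAdjoint_preservesLimits
    have : Mono (R.map n) := inferInstance
    infer_instance
  { A i := L.obj (s.A i)
    B i := L.obj (s.B i)
    α i := L.map (s.α i)
    β i := L.map (s.β i)
    mono_α i := inferInstance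
    mono_β i := inferInstance
    ι i := L.map (s.ι i)
    π i := L.map (s.π i)
    ι_β i := by rw [← L.map_comp, s.ι_β]
    zero i := by rw [← L.map_comp, s.zero, L.map_zero]
    exact i := (s.exact i).map_of_exact L
    fac i j h := by
      obtain ⟨k, hk⟩ := s.fac i j h
      exact ⟨L.map k, by rw [← L.map_comp, hk]⟩
    sup i N n _ h := by
      have := hmono n
      exact (key n _).2 (s.sup i _ (fun j hj ↦ (key n _).1 (h j hj)))
    top N n _ h := by
      have := hmono n
      have := s.top _ (fun j ↦ (key n _).1 (h j))
      apply isIso_of_fac_id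
      have := (key n (𝟙 M)).2 ⟨inv (pullback.fst (adj.unit.app M) (R.map n)), by simp⟩
      simpa using this }

/-- Reduces testing a direct sum against `N` to testing the summands against `N ∩ M` and `N ∩ M'`.
-/
lemma fac_biprod {M M' N : C} (n : N ⟶ M ⊞ M') {Y Y' : C} (f : Y ⟶ M) (f' : Y' ⟶ M') :
    Fac (biprod.map f f') n ↔ Fac f (pullback.fst biprod.inl n) ∧
      Fac f' (pullback.fst biprod.inr n) := by
  constructor
  · rintro ⟨k, hk⟩
    exact ⟨⟨pullback.lift f (biprod.inl ≫ k) (by simp [hk]), pullback.lift_fst _ _ _⟩,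
      ⟨pullback.lift f' (biprod.inr ≫ k) (by simp [hk]), pullback.lift_fst _ _ _⟩⟩
  · rintro ⟨⟨k, hk⟩, ⟨l, hl⟩⟩
    refine ⟨biprod.desc (k ≫ pullback.snd _ _) (l ≫ pullback.snd _ _), ?_⟩
    apply biprod.hom_ext'
    · simp [← hk, pullback.condition]
    · simp [← hl, pullback.condition]

lemma shortExact_biprod {S S' : ShortComplex C} (h : S.ShortExact) (h' : S'.ShortExact) :
    (ShortComplex.mk (biprod.map S.f S'.f) (biprod.map S.g S'.g) (by
      apply biprod.hom_ext' <;> simp)).ShortExact := by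
  have := h.mono_f
  have := h'.mono_f
  have := h.epi_g
  have := h'.epi_g
  refine shortExact_of_fac _ _ _ (fun T x hx ↦ ?_)
  obtain ⟨k, hk⟩ := fac_of_shortExact h (x ≫ biprod.fst)
    (by simpa using congrArg (· ≫ biprod.fst) hx)
  obtain ⟨l, hl⟩ := fac_of_shortExact h' (x ≫ biprod.snd)
    (by simpa using congrArg (· ≫ biprod.snd) hx)
  exact ⟨biprod.lift k l, by apply biprod.hom_ext <;> simp [hk, hl]⟩

/-- The direct sum of two filtrations. -/
def biprod (s : Stages M X) {M' : C} {X' : I → C} (s' : Stages M' X') :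
    Stages (M ⊞ M') (fun i ↦ X i ⊞ X' i) where
  A i := s.A i ⊞ s'.A i
  B i := s.B i ⊞ s'.B i
  α i := biprod.map (s.α i) (s'.α i)
  β i := biprod.map (s.β i) (s'.β i)
  mono_α i := inferInstance
  mono_β i := inferInstance
  ι i := biprod.map (s.ι i) (s'.ι i)
  π i := biprod.map (s.π i) (s'.π i)
  ι_β i := by apply biprod.hom_ext' <;> simp [reassoc_of% s.ι_β, reassoc_of% s'.ι_β]
  zero i := by apply biprod.hom_ext' <;> simp [reassoc_of% s.zero, reassoc_of% s'.zero]
  exact i := shortExact_biprod (s.exact i) (s'.exact i)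
  fac i j h := by
    obtain ⟨k, hk⟩ := s.fac i j h
    obtain ⟨l, hl⟩ := s'.fac i j h
    exact ⟨biprod.map k l, by apply biprod.hom_ext' <;> simp [reassoc_of% hk, reassoc_of% hl]⟩
  sup i N n _ h := (fac_biprod _ _ _).2
    ⟨s.sup i _ (fun j hj ↦ ((fac_biprod _ _ _).1 (h j hj)).1),
      s'.sup i _ (fun j hj ↦ ((fac_biprod _ _ _).1 (h j hj)).2)⟩
  top N n _ h := by
    have := s.top (pullback.fst biprod.inl n) (fun j ↦ ((fac_biprod _ _ _).1 (h j)).1)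
    have := s'.top (pullback.fst biprod.inr n) (fun j ↦ ((fac_biprod _ _ _).1 (h j)).2)
    apply isIso_of_fac_id
    have : Fac (biprod.map (𝟙 M) (𝟙 M')) n := (fac_biprod n _ _).2
      ⟨⟨inv (pullback.fst biprod.inl n), by simp⟩, ⟨inv (pullback.fst biprod.inr n), by simp⟩⟩
    rwa [show biprod.map (𝟙 M) (𝟙 M') = 𝟙 (M ⊞ M') by apply biprod.hom_ext' <;> simp] at this

section Generators

lemma shortExact_cokernel {A B : C} (f : A ⟶ B) [Mono f] :
    (ShortComplex.mk f (cokernel.π f) (cokernel.condition f)).ShortExact :=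
  shortExact_of_fac _ _ _ (fun _ x hx ↦ ⟨Abelian.monoLift f x hx, Abelian.monoLift_comp f x hx⟩)

variable {I : Type v} [HasColimits C] {G : I → C} (g : ∀ i, G i ⟶ M)

/-- Take the image of the coproduct of the generators; the listed properties are all that is used of
it. -/
lemma exists_span {K : Type v} {G : K → C} (g : ∀ k, G k ⟶ M) :
    ∃ (A : C) (α : A ⟶ M) (t : ∀ k, G k ⟶ A), Mono α ∧ (∀ k, t k ≫ α = g k) ∧
      (∀ (Z : C) (f f' : A ⟶ Z), (∀ k, t k ≫ f = t k ≫ f') → f = f') ∧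
      ∀ ⦃N : C⦄ (n : N ⟶ M) [Mono n], (∀ k, Fac (g k) n) → Fac α n := by
  let f : ∐ G ⟶ M := Sigma.desc g
  have hf (k) : Sigma.ι G k ≫ f = g k := by simp [f]
  have : Epi (factorThruImage f) := inferInstance
  refine ⟨image f, image.ι f, fun k ↦ Sigma.ι G k ≫ factorThruImage f, inferInstance,
    fun k ↦ by rw [Category.assoc, image.fac, hf], fun Z a b h ↦ ?_, fun N n _ h ↦ ?_⟩
  · rw [← cancel_epi (factorThruImage f)]
    exact Sigma.hom_ext _ _ (fun k ↦ by simpa using h k)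
  · choose l hl using h
    refine Fac.of_epi (factorThruImage f) ⟨Sigma.desc l, ?_⟩
    rw [image.fac]
    exact Sigma.hom_ext _ _ (fun i ↦ by rw [Sigma.ι_desc_assoc, hl, hf])

/-- The subobject generated by the `g i` with `i ∈ S`. -/
def span (S : Set I) : C := (exists_span fun i : S ↦ g i).choose

/-- The inclusion of `span g S`. -/
def spanι (S : Set I) : span g S ⟶ M := (exists_span fun i : S ↦ g i).choose_spec.choose

/-- The `i`-th generator, as a map to `span g S`. -/
def toSpan (S : Set I) (i : I) (hi : i ∈ S) : G i ⟶ span g S :=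
  (exists_span fun i : S ↦ g i).choose_spec.choose_spec.choose ⟨i, hi⟩

instance (S : Set I) : Mono (spanι g S) :=
  (exists_span fun i : S ↦ g i).choose_spec.choose_spec.choose_spec.1

@[simp]
lemma toSpan_ι (S : Set I) (i : I) (hi : i ∈ S) : toSpan g S i hi ≫ spanι g S = g i :=
  (exists_span fun i : S ↦ g i).choose_spec.choose_spec.choose_spec.2.1 ⟨i, hi⟩

@[simp]
lemma toSpan_ι_assoc (S : Set I) (i : I) (hi : i ∈ S) {Z : C} (h : M ⟶ Z) :
    toSpan g S i hi ≫ spanι g S ≫ h = g i ≫ h := by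
  rw [← Category.assoc, toSpan_ι]

lemma span_hom_ext {S : Set I} {Z : C} {f f' : span g S ⟶ Z}
    (h : ∀ i hi, toSpan g S i hi ≫ f = toSpan g S i hi ≫ f') : f = f' :=
  (exists_span fun i : S ↦ g i).choose_spec.choose_spec.choose_spec.2.2.1 Z f f'
    (fun k ↦ h k.1 k.2)

lemma fac_spanι {S : Set I} {N : C} (n : N ⟶ M) [Mono n] (h : ∀ i ∈ S, Fac (g i) n) :
    Fac (spanι g S) n :=
  (exists_span fun i : S ↦ g i).choose_spec.choose_spec.choose_spec.2.2.2 n (fun k ↦ h k.1 k.2)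

lemma fac_spanι_spanι {S T : Set I} (h : S ⊆ T) : Fac (spanι g S) (spanι g T) :=
  fac_spanι g _ (fun i hi ↦ ⟨toSpan g T i (h hi), by simp⟩)

/-- The map `span g S ⟶ span g T` for `S ⊆ T`. -/
def spanMap {S T : Set I} (h : S ⊆ T) : span g S ⟶ span g T := (fac_spanι_spanι g h).choose

@[simp]
lemma spanMap_ι {S T : Set I} (h : S ⊆ T) : spanMap g h ≫ spanι g T = spanι g S :=
  (fac_spanι_spanι g h).choose_spec

@[simp]
lemma toSpan_spanMap {S T : Set I} (h : S ⊆ T) (i : I) (hi : i ∈ S) :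
    toSpan g S i hi ≫ spanMap g h = toSpan g T i (h hi) := by
  rw [← cancel_mono (spanι g T)]
  simp

@[simp]
lemma spanMap_ι_assoc {S T : Set I} (h : S ⊆ T) {Z : C} (f : M ⟶ Z) :
    spanMap g h ≫ spanι g T ≫ f = spanι g S ≫ f := by
  rw [← Category.assoc, spanMap_ι]

instance {S T : Set I} (h : S ⊆ T) : Mono (spanMap g h) := mono_of_mono_fac (spanMap_ι g h)

variable [LinearOrder I]

/-- The filtration of `M` obtained by adding the generators one by one. -/
def ofGenerators (hg : ∀ ⦃N : C⦄ (n : N ⟶ M) [Mono n], (∀ i, Fac (g i) n) → IsIso n) :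
    Stages M (fun i ↦ cokernel (spanMap g (Set.Iio_subset_Iic_self (a := i)))) where
  A i := span g (Set.Iio i)
  B i := span g (Set.Iic i)
  α i := spanι g _
  β i := spanι g _
  ι i := spanMap g _
  π i := cokernel.π _
  ι_β i := spanMap_ι g _
  zero i := cokernel.condition _
  exact i := shortExact_cokernel _
  fac i j h := fac_spanι_spanι g (fun k hk ↦ lt_of_le_of_lt hk h)
  sup i N n _ h := fac_spanι g _ (fun j hj ↦ Fac.trans ⟨toSpan g _ j Set.self_mem_Iic, by simp⟩ (h j hj))
  top N n _ h := hg n (fun j ↦ Fac.trans ⟨toSpan g _ j Set.self_mem_Iic, by simp⟩ (h j))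

/-- The generators before `i` die in the quotient, so it is generated by `g i` alone. -/
lemma epi_toSpan_cokernel (i : I) :
    Epi (toSpan g (Set.Iic i) i Set.self_mem_Iic ≫
      cokernel.π (spanMap g (Set.Iio_subset_Iic_self (a := i)))) := by
  rw [Preadditive.epi_iff_cancel_zero]
  intro Z f hf
  rw [← cancel_epi (cokernel.π _), comp_zero]
  refine span_hom_ext g (fun j hj ↦ ?_)
  rw [comp_zero]
  obtain rfl | hj' := (Set.mem_Iic.1 hj).eq_or_lt
  · simpa using hf
  · rw [← toSpan_spanMap g (Set.Iio_subset_Iic_self (a := i)) j hj']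
    simp

/-- Since `r` kills the earlier generators it descends to the quotient and splits the epimorphism
from `G i`. -/
lemma isIso_toSpan_cokernel (i : I) (r : M ⟶ G i) (hr : g i ≫ r = 𝟙 _)
    (hr' : ∀ j < i, g j ≫ r = 0) :
    IsIso (toSpan g (Set.Iic i) i Set.self_mem_Iic ≫
      cokernel.π (spanMap g (Set.Iio_subset_Iic_self (a := i)))) := by
  have := epi_toSpan_cokernel g i
  let q : cokernel (spanMap g (Set.Iio_subset_Iic_self (a := i))) ⟶ G i :=
    cokernel.desc _ (spanι g _ ≫ r) (span_hom_ext g (fun j hj ↦ by simp [hr' j hj]))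
  have hq : (toSpan g (Set.Iic i) i Set.self_mem_Iic ≫
      cokernel.π (spanMap g (Set.Iio_subset_Iic_self (a := i)))) ≫ q = 𝟙 _ := by
    simp [q, hr]
  have := SplitMono.mono ⟨q, hq⟩
  exact isIso_of_mono_of_epi _

/-- The filtration of a coproduct by partial coproducts. -/
def coproduct (G : I → C) : Stages (∐ G) G :=
  (ofGenerators (Sigma.ι G) (fun N n _ h ↦ by
    choose k hk using h
    exact isIso_of_fac_id n ⟨Sigma.desc k, Sigma.hom_ext _ _ (fun i ↦ by simp [hk])⟩)).ofIso
    (fun i ↦ by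
      classical
      have := isIso_toSpan_cokernel (Sigma.ι G) i (Sigma.π G i) (by simp)
        (fun j hj ↦ Sigma.ι_π_of_ne _ hj.ne)
      exact (asIso (toSpan (Sigma.ι G) (Set.Iic i) i Set.self_mem_Iic ≫
        cokernel.π (spanMap (Sigma.ι G) (Set.Iio_subset_Iic_self (a := i))))).symm)

end Generators

/-- The filtration with a single layer. -/
def single {I : Type w} [LinearOrder I] [Unique I] (M : C) : Stages M (fun _ : I ↦ M) where
  A _ := ⊥_ C
  B _ := M
  α _ := 0
  β _ := 𝟙 M
  ι _ := 0
  π _ := 𝟙 M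
  ι_β _ := by simp
  zero _ := by simp
  exact _ := shortExact_of_fac _ _ _ (fun T x hx ↦ ⟨0, by simpa using hx.symm⟩)
  fac i j h := (h.ne (Subsingleton.elim i j)).elim
  sup _ _ n _ _ := ⟨0, by simp⟩
  top N n _ h := isIso_of_fac_id n (h default)

/-- The filtration of the zero object without any layer. -/
def empty {I : Type w} [LinearOrder I] [IsEmpty I] (hM : IsZero M) (X : I → C) : Stages M X where
  A := isEmptyElim
  B := isEmptyElim
  α i := isEmptyElim i
  β i := isEmptyElim i
  mono_α i := isEmptyElim i
  mono_β i := isEmptyElim i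
  ι i := isEmptyElim i
  π i := isEmptyElim i
  ι_β i := isEmptyElim i
  zero i := isEmptyElim i
  exact i := isEmptyElim i
  fac i := isEmptyElim i
  sup i := isEmptyElim i
  top _ n _ _ := isIso_of_fac_id n ⟨0, hM.eq_of_src _ _⟩

end Stages

end QuiverRep

end

/-! ### Closure properties of `Filt`, `ext` and `sFilt`. -/

noncomputable section

namespace QuiverRep

attribute [-instance] catToReflQuiver

section FiltClosure

universe u'

variable {C : Type u} [Category.{v} C]

lemma sums.exists_iso {P : ObjectProperty C} {M : C} [HasColimits C] (h : sums P M) :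
    ∃ (I : Type v) (X : I → C), (∀ i, P (X i)) ∧ Nonempty (M ≅ ∐ X) := by
  obtain ⟨I, ⟨h⟩⟩ := h
  exact ⟨I, fun i ↦ h.diag.obj ⟨i⟩, fun i ↦ h.prop_diag_obj _, ⟨(h.isColimit.coconePointUniqueUpToIso
    (colimit.isColimit _)) ≪≫ HasColimit.isoOfNatIso Discrete.natIsoFunctor⟩⟩

lemma le_sums (P : ObjectProperty C) : P ≤ sums P := fun M hM ↦
  ⟨PUnit, ⟨{
    diag := (Functor.const _).obj M
    ι := 𝟙 _
    isColimit :=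
      { desc s := s.ι.app ⟨⟨⟩⟩
        fac := by
          rintro s ⟨⟨⟩⟩
          exact Category.id_comp _
        uniq s m hm := by simpa using hm ⟨⟨⟩⟩ }
    prop_diag_obj _ := hM }⟩⟩

variable [Abelian C]

lemma Filt.mono {P P' : ObjectProperty C} (h : P ≤ P') : Filt P ≤ Filt P' := by
  rintro M ⟨J, i₁, i₂, i₃, i₄, i₅, F, h₁, h₂, h₃, h₄, h₅⟩
  refine ⟨J, i₁, i₂, i₃, i₄, i₅, F, h₁, h₂, h₃, fun j hj ↦ ?_, h₅⟩
  obtain ⟨Y, hY, e⟩ := h₄ j hj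
  exact ⟨Y, h _ hY, e⟩

lemma Filt.of_iso {P : ObjectProperty C} {M M' : C} (e : M ≅ M') (h : Filt P M) : Filt P M' := by
  obtain ⟨J, i₁, i₂, i₃, i₄, i₅, F, h₁, h₂, h₃, h₄, ⟨e'⟩⟩ := h
  exact ⟨J, i₁, i₂, i₃, i₄, i₅, F, h₁, h₂, h₃, h₄, ⟨e' ≪≫ e⟩⟩

lemma sFilt.mono {P P' : ObjectProperty C} (h : P ≤ P') : sFilt P ≤ sFilt P' :=
  fun _ ⟨N, hN⟩ ↦ ⟨N, Filt.mono h _ hN⟩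

/-- A short exact sequence as a filtration with two layers. -/
def Stages.two {X Y Z : C} {f : X ⟶ Y} {g : Y ⟶ Z} {w : f ≫ g = 0}
    (h : (ShortComplex.mk f g w).ShortExact) :
    Stages Y (fun b : ULift.{v} Bool ↦ if b.down then Z else X) where
  A b := if b.down then X else ⊥_ C
  B b := if b.down then Y else X
  α := fun ⟨b⟩ ↦ match b with
    | true => f
    | false => 0
  β := fun ⟨b⟩ ↦ match b with
    | true => 𝟙 Y
    | false => f
  mono_α := by
    have := h.mono_f
    rintro ⟨_ | _⟩
    · exact inferInstanceAs (Mono (0 : ⊥_ C ⟶ Y))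
    · exact this
  mono_β := by
    have := h.mono_f
    rintro ⟨_ | _⟩
    · exact this
    · exact inferInstanceAs (Mono (𝟙 Y))
  ι := fun ⟨b⟩ ↦ match b with
    | true => f
    | false => 0
  π := fun ⟨b⟩ ↦ match b with
    | true => g
    | false => 𝟙 X
  ι_β := by
    rintro ⟨_ | _⟩
    · exact zero_comp
    · exact Category.comp_id f
  zero := by
    rintro ⟨_ | _⟩
    · exact zero_comp
    · exact w
  exact := by
    rintro ⟨_ | _⟩
    · exact shortExact_of_fac (0 : ⊥_ C ⟶ X) (𝟙 X) zero_comp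
        (fun T x hx ↦ ⟨0, by simpa using hx.symm⟩)
    · exact h
  fac := by
    rintro ⟨_ | _⟩ ⟨_ | _⟩ hij
    · exact (lt_irrefl _ hij).elim
    · exact .refl _
    · exact (not_lt_of_ge (show (ULift.up false : ULift.{v} Bool) ≤ ULift.up true from
        Bool.false_le _) hij).elim
    · exact (lt_irrefl _ hij).elim
  sup := by
    rintro ⟨_ | _⟩ N n _ hn
    · exact ⟨0, zero_comp⟩
    · exact hn ⟨false⟩ (show false < true by decide)
  top N n _ hn := isIso_of_fac_id n (hn ⟨true⟩)

variable [HasColimits C] [AB5 C]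

lemma le_filt (P : ObjectProperty C) : P ≤ Filt P := fun M hM ↦
  (Stages.single (I := PUnit.{v + 1}) M).filt (fun _ ↦ hM)

lemma le_finExt (P : ObjectProperty C) : P ≤ finExt P := fun M hM ↦
  (Stages.single (I := PUnit.{v + 1}) M).finExt (fun _ ↦ hM)

lemma filt_of_isZero (P : ObjectProperty C) {M : C} (hM : IsZero M) : Filt P M :=
  (Stages.empty (I := PEmpty.{v + 1}) hM (fun _ ↦ M)).filt (fun i ↦ i.elim)

lemma finExt_of_isZero (P : ObjectProperty C) {M : C} (hM : IsZero M) : finExt P M :=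
  (Stages.empty (I := PEmpty.{v + 1}) hM (fun _ ↦ M)).finExt (fun i ↦ i.elim)

/-- Concatenation is indexed by a lexicographic sum, which is again well-ordered. -/
lemma Stages.filt_filt {P : ObjectProperty C} {M : C} {I : Type v} [LinearOrder I]
    [WellFoundedLT I] {X : I → C} (s : Stages M X) (hX : ∀ i, Filt P (X i)) : Filt P M := by
  choose K _ _ Y hY t using fun i ↦ (hX i).exists_stages
  exact (s.concat (fun i ↦ (t i).some)).filt (fun p ↦ hY p.1 p.2)

lemma Stages.finExt_finExt {P : ObjectProperty C} {M : C} {I : Type v} [LinearOrder I]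
    [Finite I] {X : I → C} (s : Stages M X) (hX : ∀ i, QuiverRep.finExt P (X i)) : QuiverRep.finExt P M := by
  choose K _ _ Y hY t using fun i ↦ (hX i).exists_stages
  have : Finite (Σₗ i, K i) := inferInstanceAs (Finite (Σ i, K i))
  exact (s.concat (fun i ↦ (t i).some)).finExt (fun p ↦ hY p.1 p.2)

lemma filt_filt (P : ObjectProperty C) : Filt (Filt P) = Filt P := by
  refine le_antisymm (fun M hM ↦ ?_) (Filt.mono (le_filt P))
  obtain ⟨I, _, _, X, hX, ⟨s⟩⟩ := hM.exists_stages
  exact s.filt_filt hX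

lemma finExt_of_shortExact (P : ObjectProperty C) {X Y Z : C} {f : X ⟶ Y} {g : Y ⟶ Z}
    {w : f ≫ g = 0} (h : (ShortComplex.mk f g w).ShortExact) (hX : finExt P X)
    (hZ : finExt P Z) : finExt P Y :=
  (Stages.two h).finExt_finExt (by rintro ⟨_ | _⟩ <;> assumption)

lemma filt_coproduct {P : ObjectProperty C} {I : Type v} (X : I → C) (hX : ∀ i, Filt P (X i)) :
    Filt P (∐ X) := by
  obtain ⟨_, _⟩ := exists_wellFoundedLT I
  exact (Stages.coproduct X).filt_filt hX

lemma sums_le_filt (P : ObjectProperty C) : sums P ≤ Filt P := by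
  intro M hM
  obtain ⟨I, X, hX, ⟨e⟩⟩ := hM.exists_iso
  exact (filt_coproduct X (fun i ↦ le_filt P _ (hX i))).of_iso e.symm

lemma filt_map {P : ObjectProperty C} {D : Type u'} [Category.{v} D] [Abelian D] [HasColimits D]
    [AB5 D] {P' : ObjectProperty D} {L : C ⥤ D} {R : D ⥤ C} (adj : L ⊣ R)
    [PreservesFiniteLimits L] (hP : ∀ X, P X → Filt P' (L.obj X)) {M : C} (hM : Filt P M) :
    Filt P' (L.obj M) := by
  obtain ⟨I, _, _, X, hX, ⟨s⟩⟩ := hM.exists_stages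
  exact (s.map L adj).filt_filt (fun i ↦ hP _ (hX i))

/-- In an abelian category a retract is complemented by the cokernel of its inclusion. -/
lemma sFilt_iff_retract (P : ObjectProperty C) (M : C) :
    sFilt P M ↔ ∃ (N : C) (_ : Retract M N), Filt P N := by
  constructor
  · rintro ⟨N, hN⟩
    exact ⟨_, ⟨biprod.inl, biprod.fst, by simp⟩, hN⟩
  · rintro ⟨N, r, hN⟩
    have : Mono r.i := SplitMono.mono ⟨r.r, r.retract⟩
    let S := ShortComplex.Splitting.ofExactOfRetraction _
      (Stages.shortExact_cokernel r.i).exact r.r r.retract inferInstance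
    exact ⟨_, hN.of_iso S.isoBinaryBiproduct⟩

lemma sFilt.of_retract {P : ObjectProperty C} {M N : C} (hN : sFilt P N) (r : Retract M N) :
    sFilt P M := by
  rw [sFilt_iff_retract] at hN ⊢
  obtain ⟨T, r', hT⟩ := hN
  exact ⟨T, r.trans r', hT⟩

lemma filt_le_sFilt (P : ObjectProperty C) : Filt P ≤ sFilt P := fun M hM ↦
  (sFilt_iff_retract P M).2 ⟨M, Retract.refl _, hM⟩

lemma le_sFilt (P : ObjectProperty C) : P ≤ sFilt P := (le_filt P).trans (filt_le_sFilt P)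

/-- Choose complements `N i` making `X i ⊞ N i` filtered. Adding the filtration of `∐ N` by partial
coproducts to that of `M` gives a filtration of `M ⊞ ∐ N` with these layers. -/
lemma filt_sFilt_le (P : ObjectProperty C) : Filt (sFilt P) ≤ sFilt P := by
  intro M hM
  obtain ⟨I, _, _, X, hX, ⟨s⟩⟩ := hM.exists_stages
  choose N hN using hX
  exact ⟨∐ N, (s.biprod (Stages.coproduct N)).filt_filt hN⟩

lemma sFilt_sFilt (P : ObjectProperty C) : sFilt (sFilt P) = sFilt P := by
  refine le_antisymm (fun M hM ↦ ?_) (sFilt.mono (le_sFilt P))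
  obtain ⟨N, r, hN⟩ := (sFilt_iff_retract _ _).1 hM
  exact (filt_sFilt_le P _ hN).of_retract r

lemma sFilt_map {P : ObjectProperty C} {D : Type u'} [Category.{v} D] [Abelian D] [HasColimits D]
    [AB5 D] {P' : ObjectProperty D} {L : C ⥤ D} {R : D ⥤ C} (adj : L ⊣ R)
    [PreservesFiniteLimits L] (hP : ∀ X, P X → Filt P' (L.obj X)) {M : C} (hM : sFilt P M) :
    sFilt P' (L.obj M) := by
  rw [sFilt_iff_retract] at hM ⊢
  obtain ⟨N, r, hN⟩ := hM
  exact ⟨_, r.map L, filt_map adj hP hN⟩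

end FiltClosure

end QuiverRep

end

/-! ### The maps `φ_x` and their cokernels as functors. -/

noncomputable section

namespace QuiverRep

attribute [-instance] catToReflQuiver

section Chase

variable {C : Type u} [Category.{v} C] [Abelian C]

variable {S T : ShortComplex C} (hS : S.ShortExact) (hT : T.ShortExact) (φ : S ⟶ T)

include hS hT

/-- Part of the snake lemma: the kernel of the map of cokernels is the image of `ker τ₃` under the
connecting map. -/
lemma mono_cokernelMap_of_mono_τ₃ [Mono φ.τ₃] :
    Mono (cokernel.map φ.τ₁ φ.τ₂ S.f T.f φ.comm₁₂) := by
  have := hS.epi_g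
  have := hT.mono_f
  refine Preadditive.mono_of_cancel_zero _ (fun {Z} t ht ↦ ?_)
  obtain ⟨Z₁, e₁, _, a, ha⟩ := surjective_up_to_refinements_of_epi (cokernel.π φ.τ₁) t
  have h₁ : (a ≫ T.f) ≫ cokernel.π φ.τ₂ = 0 := by
    simpa [ht] using (congrArg (· ≫ cokernel.map φ.τ₁ φ.τ₂ S.f T.f φ.comm₁₂) ha).symm
  obtain ⟨Z₂, e₂, _, b, hb⟩ :=
    (ShortComplex.exact_cokernel φ.τ₂).exact_up_to_refinements (a ≫ T.f) h₁
  dsimp at b hb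
  have h₂ : b ≫ S.g = 0 := by
    rw [← cancel_mono φ.τ₃, Category.assoc, ← φ.comm₂₃, ← reassoc_of% hb]
    simp
  obtain ⟨c, hc⟩ := fac_of_shortExact hS b h₂
  have h₃ : e₂ ≫ a = c ≫ φ.τ₁ := by
    rw [← cancel_mono T.f, Category.assoc, hb, Category.assoc, φ.comm₁₂, reassoc_of% hc]
  rw [← cancel_epi e₁, ← cancel_epi e₂, ha, reassoc_of% h₃]
  simp

/-- Snake lemma again: as `ker τ₂ = 0`, the connecting map embeds `ker τ₃` into the kernel of the
map of cokernels. -/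
lemma mono_τ₃_of_mono_cokernelMap [Mono φ.τ₂]
    [Mono (cokernel.map φ.τ₁ φ.τ₂ S.f T.f φ.comm₁₂)] : Mono φ.τ₃ := by
  have := hS.epi_g
  have := hT.mono_f
  refine Preadditive.mono_of_cancel_zero _ (fun {Z} t ht ↦ ?_)
  obtain ⟨Z₁, e₁, _, b, hb⟩ := surjective_up_to_refinements_of_epi S.g t
  obtain ⟨a, ha⟩ := fac_of_shortExact hT (b ≫ φ.τ₂)
    (by rw [Category.assoc, φ.comm₂₃, ← reassoc_of% hb, ht, comp_zero])
  have h₁ : a ≫ cokernel.π φ.τ₁ = 0 := by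
    rw [← cancel_mono (cokernel.map φ.τ₁ φ.τ₂ S.f T.f φ.comm₁₂)]
    simp [reassoc_of% ha]
  obtain ⟨Z₂, e₂, _, c, hc⟩ := (ShortComplex.exact_cokernel φ.τ₁).exact_up_to_refinements a h₁
  dsimp at c hc
  have h₂ : e₂ ≫ b = c ≫ S.f := by
    rw [← cancel_mono φ.τ₂, Category.assoc, ← ha, reassoc_of% hc, φ.comm₁₂, Category.assoc]
  rw [← cancel_epi e₁, ← cancel_epi e₂, hb, reassoc_of% h₂]
  simp

lemma mono_τ₂_of_mono [Mono φ.τ₁] [Mono φ.τ₃] : Mono φ.τ₂ := by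
  have := hT.mono_f
  refine Preadditive.mono_of_cancel_zero _ (fun {Z} t ht ↦ ?_)
  obtain ⟨a, ha⟩ := fac_of_shortExact hS t
    (by rw [← cancel_mono φ.τ₃, Category.assoc, ← φ.comm₂₃, reassoc_of% ht, zero_comp, zero_comp])
  have : a = 0 := by
    rw [← cancel_mono φ.τ₁, ← cancel_mono T.f, Category.assoc, φ.comm₁₂, reassoc_of% ha, ht]
    simp
  rw [← ha, this, zero_comp]

end Chase

section Functors

variable {Q : Type v} [Quiver.{v} Q] {A : Type u} [Category.{v} A] [HasColimits A]

/-- The functor sending `F` to the source of `φ_x^F`. -/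
def inc (x : Q) : Rep Q A ⥤ A where
  obj F := ∐ fun a : (Σ w : Q, w ⟶ x) => F.obj ((Paths.of Q).obj a.1)
  map {F G} η := Limits.Sigma.map (f := fun a : (Σ w : Q, w ⟶ x) ↦ F.obj ((Paths.of Q).obj a.1))
    (g := fun a : (Σ w : Q, w ⟶ x) ↦ G.obj ((Paths.of Q).obj a.1))
    (fun a ↦ η.app ((Paths.of Q).obj a.1))
  map_id F := Sigma.hom_ext _ _ (fun a ↦ by simp)
  map_comp η θ := Sigma.hom_ext _ _ (fun a ↦ by simp)

/-- Evaluation at a vertex. -/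
abbrev ev (x : Q) : Rep Q A ⥤ A := (evaluation _ _).obj ((Paths.of Q).obj x)

/-- The map `φ_x^F`, with source and target given by functors. -/
def phiMap (F : Rep Q A) (x : Q) : (inc x).obj F ⟶ F.obj ((Paths.of Q).obj x) := phi F x

lemma inc_naturality {F G : Rep Q A} (η : F ⟶ G) (x : Q) :
    (inc x).map η ≫ phiMap G x = phiMap F x ≫ η.app ((Paths.of Q).obj x) :=
  Sigma.hom_ext _ _ (fun a ↦ by simp [inc, phi, phiMap, -Paths.of_map])

/-- The maps `φ_x` as a natural transformation. -/
def phiNat (x : Q) : inc (A := A) x ⟶ ev x where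
  app F := phiMap F x
  naturality _ _ η := inc_naturality η x

/-- `inc x` is a restriction functor followed by a colimit. -/
def incIso (x : Q) : inc (A := A) x ≅
    (Functor.whiskeringLeft _ _ A).obj
      (Discrete.functor fun a : (Σ w : Q, w ⟶ x) ↦ (Paths.of Q).obj a.1) ⋙ colim :=
  NatIso.ofComponents (fun F ↦ HasColimit.isoOfNatIso (Discrete.compNatIsoDiscrete _ _).symm)
    (fun η ↦ Sigma.hom_ext _ _ (fun a ↦ by simp [inc]))

instance (x : Q) : PreservesColimits (inc (A := A) x) :=
  preservesColimits_of_natIso (incIso x).symm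


/-- The summand of the source of `φ_x^F` corresponding to an arrow. -/
def ιInc (F : Rep Q A) {w x : Q} (a : w ⟶ x) : F.obj ((Paths.of Q).obj w) ⟶ (inc x).obj F :=
  Sigma.ι (fun a : (Σ w : Q, w ⟶ x) ↦ F.obj ((Paths.of Q).obj a.1)) ⟨w, a⟩

lemma ιInc_phiMap (F : Rep Q A) {w x : Q} (a : w ⟶ x) :
    ιInc F a ≫ phiMap F x = F.map ((Paths.of Q).map a) :=
  Sigma.ι_desc _ _

lemma ιInc_map {F G : Rep Q A} (η : F ⟶ G) {w x : Q} (a : w ⟶ x) :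
    ιInc F a ≫ (inc x).map η = η.app _ ≫ ιInc G a :=
  Sigma.ι_map (fun a : (Σ w : Q, w ⟶ x) ↦ η.app ((Paths.of Q).obj a.1)) ⟨w, a⟩

lemma inc_hom_ext {x : Q} {F : Rep Q A} {Z : A} {f g : (inc x).obj F ⟶ Z}
    (h : ∀ (w : Q) (a : w ⟶ x), ιInc F a ≫ f = ιInc F a ≫ g) : f = g :=
  Sigma.hom_ext _ _ (fun a ↦ h a.1 a.2)

/-- `inc x` only sees the sources of arrows into `x`, which is what makes induction along arrows
possible. -/
lemma isIso_inc_map {F G : Rep Q A} (η : F ⟶ G) (x : Q)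
    (h : ∀ w, (w ⟶ x) → IsIso (η.app ((Paths.of Q).obj w))) : IsIso ((inc x).map η) := by
  let d : (inc x).obj G ⟶ (inc x).obj F := Sigma.desc fun a ↦
    have := h a.1 a.2
    inv (η.app ((Paths.of Q).obj a.1)) ≫ ιInc F a.2
  have hd {w : Q} (a : w ⟶ x) [IsIso (η.app ((Paths.of Q).obj w))] :
      ιInc G a ≫ d = inv (η.app ((Paths.of Q).obj w)) ≫ ιInc F a := Sigma.ι_desc _ _
  refine ⟨d, inc_hom_ext (fun w a ↦ ?_), inc_hom_ext (fun w a ↦ ?_)⟩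
  · have := h w a
    rw [← Category.assoc, ιInc_map, Category.assoc, hd]
    simp
  · have := h w a
    rw [← Category.assoc, hd, Category.assoc, ιInc_map]
    simp

variable [Abelian A]

/-- Coproducts are exact because AB5 implies AB4. -/
instance [AB5 A] (x : Q) : PreservesFiniteLimits (inc (A := A) x) := by
  have : HasFiniteBiproducts A := Abelian.hasFiniteBiproducts
  have : AB4 A := AB4.of_AB5 (C := A)
  exact preservesFiniteLimits_of_natIso (incIso x).symm

/-- The cokernel of `φ_x`, as a functor. -/
def cok (x : Q) : Rep Q A ⥤ A where
  obj F := cokernel (phiMap F x)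
  map η := cokernel.map _ _ ((inc x).map η) (η.app _) (inc_naturality η x).symm

/-- The projection to the cokernel of `φ_x`. -/
def cokπ (F : Rep Q A) (x : Q) : F.obj ((Paths.of Q).obj x) ⟶ (cok x).obj F :=
  cokernel.π (phiMap F x)

instance (F : Rep Q A) (x : Q) : Epi (cokπ F x) := inferInstanceAs (Epi (cokernel.π _))

lemma phi_cokπ (F : Rep Q A) (x : Q) : phiMap F x ≫ cokπ F x = 0 := cokernel.condition _

lemma cokπ_map {F G : Rep Q A} (η : F ⟶ G) (x : Q) :
    cokπ F x ≫ (cok x).map η = η.app _ ≫ cokπ G x :=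
  cokernel.π_desc _ _ _

lemma exists_cok_desc {F : Rep Q A} {x : Q} {Z : A} (f : F.obj ((Paths.of Q).obj x) ⟶ Z)
    (hf : phiMap F x ≫ f = 0) : ∃ g : (cok x).obj F ⟶ Z, cokπ F x ≫ g = f :=
  ⟨cokernel.desc _ f hf, cokernel.π_desc _ _ _⟩

lemma exists_lift_of_cokπ_eq_zero {F : Rep Q A} {x : Q} {Z : A}
    (t : Z ⟶ F.obj ((Paths.of Q).obj x)) (ht : t ≫ cokπ F x = 0) :
    ∃ (Z' : A) (e : Z' ⟶ Z) (_ : Epi e) (s : Z' ⟶ (inc x).obj F), e ≫ t = s ≫ phiMap F x :=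
  (ShortComplex.exact_cokernel (phiMap F x)).exact_up_to_refinements t ht

/-- A cokernel of a transformation between the colimit-preserving functors `inc x` and `ev x`;
colimits commute with cokernels. -/
instance (x : Q) : PreservesColimits (cok (A := A) x) where
  preservesColimitsOfShape := ⟨fun {D} ↦ ⟨fun {c} hc ↦ ⟨by
    have hev := isColimitOfPreserves (ev (A := A) x) hc
    have hinc := isColimitOfPreserves (inc (A := A) x) hc
    let t (j) : D.obj j ⟶ c.pt := c.ι.app j
    have key (s : Cocone (D ⋙ cok x)) : ∃ d : (cok x).obj c.pt ⟶ s.pt,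
        ∀ j, (cok x).map (t j) ≫ d = s.ι.app j := by
      let s' : Cocone (D ⋙ ev x) := Cocone.mk s.pt
        { app j := cokπ (D.obj j) x ≫ s.ι.app j
          naturality i j f := by
            have := s.w f
            dsimp at this ⊢
            rw [← this, ← Category.assoc, ← Category.assoc, cokπ_map]
            simp }
      have hs' (j) : (t j).app _ ≫ hev.desc s' = cokπ (D.obj j) x ≫ s.ι.app j :=
        hev.fac s' j
      obtain ⟨d, hd⟩ := exists_cok_desc (F := c.pt) (x := x) (hev.desc s')
        (hinc.hom_ext (fun j ↦ by
          have h₁ : (inc x).map (t j) ≫ phiMap c.pt x ≫ hev.desc s' = 0 := by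
            rw [← Category.assoc, inc_naturality, Category.assoc, hs', ← Category.assoc, phi_cokπ,
              zero_comp]
          exact h₁.trans comp_zero.symm))
      refine ⟨d, fun j ↦ ?_⟩
      rw [← cancel_epi (cokπ (D.obj j) x), ← Category.assoc, cokπ_map, Category.assoc, hd, hs']
    choose d hd using key
    exact
      { desc := d
        fac := hd
        uniq s m hm := by
          rw [← cancel_epi (cokπ c.pt x)]
          refine hev.hom_ext (fun j ↦ ?_)
          have h₁ : (t j).app _ ≫ cokπ c.pt x ≫ m = (t j).app _ ≫ cokπ c.pt x ≫ d s := by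
            rw [← Category.assoc, ← Category.assoc, ← cokπ_map, Category.assoc, Category.assoc, hd]
            exact congrArg _ (hm j)
          exact h₁ }⟩⟩⟩

lemma isIso_cok_map {F G : Rep Q A} (η : F ⟶ G) (x : Q) [IsIso ((inc x).map η)]
    [IsIso (η.app ((Paths.of Q).obj x))] : IsIso ((cok x).map η) :=
  inferInstanceAs (IsIso (cokernel.mapIso (phiMap F x) (phiMap G x) (asIso ((inc x).map η))
    (asIso (η.app ((Paths.of Q).obj x))) (inc_naturality η x).symm).hom)

section

variable [AB5 A] {S : ShortComplex (Rep Q A)} (hS : S.ShortExact) (x : Q)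

include hS

lemma mono_cok_map [Mono (phiMap S.X₃ x)] : Mono ((cok x).map S.f) :=
  have : Mono (S.mapNatTrans (phiNat x)).τ₃ := inferInstanceAs (Mono (phiMap S.X₃ x))
  mono_cokernelMap_of_mono_τ₃ (hS.map_of_exact (inc x)) (hS.map_of_exact (ev x))
    (S.mapNatTrans (phiNat x))

lemma mono_phi_of_mono_cok_map [Mono (phiMap S.X₂ x)] [Mono ((cok x).map S.f)] :
    Mono (phiMap S.X₃ x) :=
  have : Mono (S.mapNatTrans (phiNat x)).τ₂ := inferInstanceAs (Mono (phiMap S.X₂ x))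
  have : Mono (cokernel.map (S.mapNatTrans (phiNat x)).τ₁ (S.mapNatTrans (phiNat x)).τ₂ _ _
      (S.mapNatTrans (phiNat x)).comm₁₂) := inferInstanceAs (Mono ((cok x).map S.f))
  mono_τ₃_of_mono_cokernelMap (hS.map_of_exact (inc x)) (hS.map_of_exact (ev x))
    (S.mapNatTrans (phiNat x))

lemma mono_phi_of_shortExact [Mono (phiMap S.X₁ x)] [Mono (phiMap S.X₃ x)] : Mono (phiMap S.X₂ x) :=
  have : Mono (S.mapNatTrans (phiNat x)).τ₁ := inferInstanceAs (Mono (phiMap S.X₁ x))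
  have : Mono (S.mapNatTrans (phiNat x)).τ₃ := inferInstanceAs (Mono (phiMap S.X₃ x))
  mono_τ₂_of_mono (hS.map_of_exact (inc x)) (hS.map_of_exact (ev x)) (S.mapNatTrans (phiNat x))

end

lemma mono_phi_of_mono [AB5 A] {F G : Rep Q A} (η : F ⟶ G) [Mono η] (x : Q)
    [Mono (phiMap G x)] :
    Mono (phiMap F x) :=
  have : Mono ((inc x).map η ≫ phiMap G x) := mono_comp _ _
  mono_of_mono_fac (inc_naturality η x).symm

/-- An element killed by `η` vanishes in `cok`, so it comes locally from `inc x`; that lift is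
killed by the composite of the monomorphisms `(inc x).map η` and `φ_x^G`. -/
lemma mono_app_of_mono_cok_map [AB5 A] {F G : Rep Q A} (η : F ⟶ G) (x : Q) [Mono (phiMap G x)]
    [Mono ((cok x).map η)] [Mono ((inc x).map η)] : Mono (η.app ((Paths.of Q).obj x)) := by
  refine Preadditive.mono_of_cancel_zero _ (fun {Z} t ht ↦ ?_)
  have h₁ : t ≫ cokπ F x = 0 := by
    rw [← cancel_mono ((cok x).map η), Category.assoc, cokπ_map, reassoc_of% ht, zero_comp,
      zero_comp]
  obtain ⟨Z', e, _, s, hs⟩ := exists_lift_of_cokπ_eq_zero t h₁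
  have : s = 0 := by
    rw [← cancel_mono ((inc x).map η), ← cancel_mono (phiMap G x), Category.assoc, inc_naturality,
      ← reassoc_of% hs, ht]
    simp
  rw [← cancel_epi e, hs, this, zero_comp, comp_zero]

lemma epi_app_of_epi_cok_map {F G : Rep Q A} (η : F ⟶ G) (x : Q)
    [Epi ((cok x).map η)] [Epi ((inc x).map η)] : Epi (η.app ((Paths.of Q).obj x)) := by
  refine Preadditive.epi_of_cancel_zero _ (fun {Z} f hf ↦ ?_)
  obtain ⟨g, hg⟩ := exists_cok_desc f (by
    rw [← cancel_epi ((inc x).map η), ← Category.assoc, inc_naturality, Category.assoc, hf]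
    simp)
  have : g = 0 := by
    rw [← cancel_epi ((cok x).map η), ← cancel_epi (cokπ F x), ← Category.assoc, cokπ_map,
      Category.assoc, hg, hf]
    simp
  rw [← hg, this, comp_zero]

end Functors

end QuiverRep

end

/-! ### The free representations `f_x(X)`. -/

noncomputable section

namespace QuiverRep

attribute [-instance] catToReflQuiver

section Free

variable {Q : Type v} [Quiver.{v} Q] {A : Type u} [Category.{v} A] [HasColimits A]

/-- `f_x` is left adjoint to the evaluation at `x`. -/
def freeAdj (x : Q) : freeAt (A := A) x ⊣ ev x := evaluationAdjunctionRight A _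

/-- The summand of `f_x(X)(w)` corresponding to a path from `x` to `w`. -/
def ιFree {x : Q} (X : A) {w : Paths Q} (p : (Paths.of Q).obj x ⟶ w) :
    X ⟶ ((freeAt x).obj X).obj w :=
  Sigma.ι (fun _ : (Paths.of Q).obj x ⟶ w ↦ X) p

lemma ιFree_hom_ext {x : Q} {X : A} {w : Paths Q} {Z : A} {f g : ((freeAt x).obj X).obj w ⟶ Z}
    (h : ∀ p, ιFree X p ≫ f = ιFree X p ≫ g) : f = g :=
  Sigma.hom_ext _ _ h

lemma ιFree_map {x : Q} (X : A) {w w' : Paths Q} (p : (Paths.of Q).obj x ⟶ w) (q : w ⟶ w') :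
    ιFree X p ≫ ((freeAt x).obj X).map q = ιFree X (p ≫ q) :=
  Sigma.ι_desc _ _

lemma ιFree_map_app {x : Q} {X Y : A} (f : X ⟶ Y) {w : Paths Q} (p : (Paths.of Q).obj x ⟶ w) :
    ιFree X p ≫ ((freeAt x).map f).app w = f ≫ ιFree Y p :=
  Sigma.ι_desc _ _

lemma exists_ιFree_desc {x : Q} {X : A} {w : Paths Q} {Z : A}
    (f : ((Paths.of Q).obj x ⟶ w) → (X ⟶ Z)) :
    ∃ d : ((freeAt x).obj X).obj w ⟶ Z, ∀ p, ιFree X p ≫ d = f p :=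
  ⟨Sigma.desc f, fun _ ↦ Sigma.ι_desc _ _⟩

lemma freeAdj_unit_app (x : Q) (X : A) : (freeAdj x).unit.app X = ιFree X (𝟙 _) := by
  simp [freeAdj, ιFree, evaluationAdjunctionRight]
  exact Category.comp_id _

variable [Abelian A]

/-- At each vertex `f_x` is a coproduct of copies of the identity, exact by AB4. -/
instance [AB5 A] (x : Q) : PreservesFiniteLimits (freeAt (A := A) x) := by
  have : HasFiniteBiproducts A := Abelian.hasFiniteBiproducts
  have : AB4 A := AB4.of_AB5 (C := A)
  refine preservesFiniteLimits_of_evaluation _ (fun w ↦ ?_)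
  let G : A ⥤ (Discrete ((Paths.of Q).obj x ⟶ w) ⥤ A) := Functor.const _
  let e (X : A) : colimit (G.obj X) ≅ ((freeAt x).obj X).obj w :=
    HasColimit.isoOfNatIso (Discrete.natIso (fun _ ↦ Iso.refl X))
  have he (X : A) (p : (Paths.of Q).obj x ⟶ w) :
      colimit.ι (G.obj X) ⟨p⟩ ≫ (e X).hom = ιFree X p :=
    (HasColimit.isoOfNatIso_ι_hom _ _).trans (Category.id_comp _)
  have hG : PreservesFiniteLimits (G ⋙ colim) := comp_preservesFiniteLimits _ _
  have e' : G ⋙ colim ≅ freeAt x ⋙ (evaluation _ _).obj w := NatIso.ofComponents e (fun {X Y} f ↦ by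
    refine colimit.hom_ext (fun ⟨p⟩ ↦ ?_)
    have h₁ : colimit.ι (G.obj X) ⟨p⟩ ≫ colimMap (G.map f) ≫ (e Y).hom =
        colimit.ι (G.obj X) ⟨p⟩ ≫ (e X).hom ≫ ((freeAt x).map f).app w := by
      rw [ι_colimMap_assoc, reassoc_of% he, he]
      exact (ιFree_map_app f p).symm
    exact h₁)
  exact preservesFiniteLimits_of_natIso e'

/-- Case distinction on whether a path is trivial. -/
def pathCases {x w : Q} {Z : Sort*} (d : x = w → Z) (f : ∀ y, Quiver.Path x y → (y ⟶ w) → Z) :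
    Quiver.Path x w → Z
  | .nil => d (Eq.refl x)
  | .cons p a => f _ p a

lemma path_cases {x w : Q} (p : (Paths.of Q).obj x ⟶ (Paths.of Q).obj w) :
    (∃ h : x = w, p = eqToHom (congrArg (Paths.of Q).obj h)) ∨
      ∃ (y : Q) (q : (Paths.of Q).obj x ⟶ (Paths.of Q).obj y) (a : y ⟶ w),
        p = q ≫ (Paths.of Q).map a := by
  have key {x w : Q} (p : Quiver.Path x w) :
    (∃ h : x = w, (p : (Paths.of Q).obj x ⟶ (Paths.of Q).obj w) =
      eqToHom (congrArg (Paths.of Q).obj h)) ∨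
      ∃ (y : Q) (q : (Paths.of Q).obj x ⟶ (Paths.of Q).obj y) (a : y ⟶ w),
        p = q ≫ (Paths.of Q).map a := by
    cases p with
    | nil => exact .inl ⟨rfl, rfl⟩
    | cons q a => exact .inr ⟨_, q, a, rfl⟩
  exact key p

/-- A nontrivial path is uniquely a path followed by a last arrow, so `φ_w` is the inclusion of the
summands of nontrivial paths. The retraction kills the trivial path. -/
lemma exists_phiMap_retraction (x : Q) (X : A) (w : Q) :
    ∃ r, phiMap ((freeAt x).obj X) w ≫ r = 𝟙 _ := by
  obtain ⟨r, hr⟩ := exists_ιFree_desc (x := x) (w := (Paths.of Q).obj w)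
    (Z := (inc w).obj ((freeAt x).obj X)) (X := X)
    (pathCases (fun _ ↦ 0) (fun y p a ↦ ιFree X (w := (Paths.of Q).obj y) p ≫ ιInc _ a))
  refine ⟨r, inc_hom_ext (fun y a ↦ ιFree_hom_ext (fun p ↦ ?_))⟩
  rw [← Category.assoc (ιInc _ _), ιInc_phiMap, ← Category.assoc, ιFree_map, hr, Category.comp_id]
  rfl

instance (x : Q) (X : A) (w : Q) : Mono (phiMap ((freeAt x).obj X) w) := by
  obtain ⟨r, hr⟩ := exists_phiMap_retraction x X w
  exact SplitMono.mono ⟨r, hr⟩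

lemma isZero_cok_freeAt {x w : Q} (h : x ≠ w) (X : A) : IsZero ((cok w).obj ((freeAt x).obj X)) := by
  have : cokπ ((freeAt x).obj X) w = 0 := by
    refine ιFree_hom_ext (fun p ↦ ?_)
    rw [comp_zero]
    obtain ⟨h', _⟩ | ⟨y, q, a, rfl⟩ := path_cases p
    · exact (h h').elim
    · rw [← ιFree_map, ← ιInc_phiMap, Category.assoc, Category.assoc, phi_cokπ, comp_zero,
        comp_zero]
  rw [IsZero.iff_id_eq_zero, ← cancel_epi (cokπ ((freeAt x).obj X) w), this]
  simp

/-- Only the summand of the trivial path survives in the cokernel. -/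
lemma isIso_cokπ_freeAt (x : Q) (X : A) :
    IsIso (ιFree X (𝟙 ((Paths.of Q).obj x)) ≫ cokπ ((freeAt x).obj X) x) := by
  obtain ⟨r, hr⟩ := exists_ιFree_desc (x := x) (w := (Paths.of Q).obj x) (Z := X) (X := X)
    (pathCases (fun _ ↦ 𝟙 X) (fun y p a ↦ 0))
  obtain ⟨g, hg⟩ := exists_cok_desc (F := (freeAt x).obj X) r (inc_hom_ext (fun y a ↦
    ιFree_hom_ext (fun p ↦ by
      rw [← Category.assoc (ιInc _ _), ιInc_phiMap, ← Category.assoc, ιFree_map, hr, comp_zero,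
        comp_zero]
      rfl)))
  have h₁ : (ιFree X (𝟙 ((Paths.of Q).obj x)) ≫ cokπ ((freeAt x).obj X) x) ≫ g = 𝟙 X := by
    rw [Category.assoc, hg, hr]
    rfl
  refine ⟨g, h₁, ?_⟩
  rw [← cancel_epi (cokπ _ x)]
  refine ιFree_hom_ext (fun p ↦ ?_)
  rw [reassoc_of% hg, reassoc_of% hr, Category.comp_id]
  obtain ⟨_, rfl⟩ | ⟨y, q, a, rfl⟩ := path_cases p
  · exact Category.id_comp _
  · have h₂ : ιFree X (q ≫ (Paths.of Q).map a) ≫ cokπ ((freeAt x).obj X) x = 0 := by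
      rw [← ιFree_map, ← ιInc_phiMap, Category.assoc, Category.assoc, phi_cokπ, comp_zero,
        comp_zero]
    exact zero_comp.trans h₂.symm

lemma isLeftRooted_wellFounded (hQ : IsLeftRooted Q) :
    WellFounded (fun w x : Q ↦ Nonempty (w ⟶ x)) := by
  rw [wellFounded_iff_isEmpty_descending_chain]
  exact ⟨fun ⟨x, hx⟩ ↦ (hQ x).elim (fun n ↦ (hx n).some)⟩

variable (hQ : IsLeftRooted Q)

include hQ

/-- Well-founded induction along arrows: if `η` is invertible at all sources of arrows into `w`,
then so is `(inc w).map η`, and the four-lemma arguments above apply at `w`. -/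
lemma isIso_of_isIso_cok_map [AB5 A] {F G : Rep Q A} (η : F ⟶ G) [∀ x, Mono (phiMap G x)]
    [∀ x, IsIso ((cok x).map η)] : IsIso η := by
  have (w : Q) : IsIso (η.app ((Paths.of Q).obj w)) := by
    induction w using (isLeftRooted_wellFounded hQ).induction with
    | _ w hw =>
    have := isIso_inc_map η w (fun y a ↦ hw y ⟨a⟩)
    have := mono_app_of_mono_cok_map η w
    have := epi_app_of_epi_cok_map η w
    exact isIso_of_mono_of_epi _
  have (w : Paths Q) : IsIso (η.app w) := this w
  exact NatIso.isIso_of_isIso_app η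

end Free

/-! ### Subrepresentations generated by sets of vertices, and their layers. -/

section Generators

variable {Q : Type v} [Quiver.{v} Q] {A : Type u} [Category.{v} A] [HasColimits A] (F : Rep Q A)

/-- The representation `F` is generated by the `f_x(F(x))`. -/
def gen (x : Q) : (freeAt x).obj (F.obj ((Paths.of Q).obj x)) ⟶ F := (freeAdj x).counit.app F

lemma ιFree_gen (x : Q) : ιFree _ (𝟙 _) ≫ (gen F x).app ((Paths.of Q).obj x) = 𝟙 _ := by
  rw [← freeAdj_unit_app]
  exact (freeAdj x).right_triangle_components F

variable [Abelian A]

lemma isIso_of_fac_gen ⦃N : Rep Q A⦄ (n : N ⟶ F) [Mono n] (h : ∀ x, Fac (gen F x) n) : IsIso n := by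
  have (w : Q) : IsIso (n.app ((Paths.of Q).obj w)) := by
    obtain ⟨k, hk⟩ := h w
    refine isIso_of_fac_id _ ⟨ιFree _ (𝟙 _) ≫ k.app _, ?_⟩
    rw [Category.assoc, ← NatTrans.comp_app, hk, ιFree_gen]
  have (w : Paths Q) : IsIso (n.app w) := this w
  exact NatIso.isIso_of_isIso_app n

open Stages

lemma isIso_spanι_app (S : Set Q) {w : Q} (hw : w ∈ S) :
    IsIso ((spanι (gen F) S).app ((Paths.of Q).obj w)) := by
  refine isIso_of_fac_id _ ⟨ιFree _ (𝟙 _) ≫ (toSpan (gen F) S w hw).app _, ?_⟩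
  rw [Category.assoc, ← NatTrans.comp_app, toSpan_ι, ιFree_gen]

/-- The span is a quotient of a coproduct of `f_x(F(x))` with `x ∈ S`, on which `cok w` vanishes,
and `cok w` preserves colimits. -/
lemma isZero_cok_span (S : Set Q) {w : Q} (hw : w ∉ S) : IsZero ((cok w).obj (span (gen F) S)) := by
  let f : (∐ fun x : S ↦ (freeAt x.1).obj (F.obj ((Paths.of Q).obj x.1))) ⟶ span (gen F) S :=
    Sigma.desc (fun x ↦ toSpan (gen F) S x.1 x.2)
  have : Epi f := ⟨fun a b h ↦ span_hom_ext _ (fun i hi ↦ by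
    simpa [f] using congrArg (Sigma.ι (fun x : S ↦
      (freeAt x.1).obj (F.obj ((Paths.of Q).obj x.1))) ⟨i, hi⟩ ≫ ·) h)⟩
  have h₁ := isColimitOfPreserves (cok (A := A) w) (coproductIsCoproduct
    (fun x : S ↦ (freeAt x.1).obj (F.obj ((Paths.of Q).obj x.1))))
  have h₂ : IsZero ((cok w).obj (∐ fun x : S ↦ (freeAt x.1).obj (F.obj ((Paths.of Q).obj x.1)))) := by
    rw [IsZero.iff_id_eq_zero]
    exact h₁.hom_ext (fun ⟨x⟩ ↦ (isZero_cok_freeAt (fun h : x.1 = w ↦ hw (h ▸ x.2)) _).eq_of_src _ _)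
  exact IsZero.of_epi ((cok w).map f) h₂

variable [AB5 A]

section Layer

variable {S T : Set Q} (hST : S ⊆ T)

lemma isIso_spanMap_app {w : Q} (hw : w ∈ S) :
    IsIso ((spanMap (gen F) hST).app ((Paths.of Q).obj w)) := by
  have := isIso_spanι_app F S hw
  have := isIso_spanι_app F T (hST hw)
  have h := congr_app (spanMap_ι (gen F) hST) ((Paths.of Q).obj w)
  rw [NatTrans.comp_app] at h
  exact IsIso.of_isIso_fac_right h

lemma isZero_layer_of_mem {w : Q} (hw : w ∈ S) :
    IsZero ((cokernel (spanMap (gen F) hST)).obj ((Paths.of Q).obj w)) :=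
  ((shortExact_cokernel (spanMap (gen F) hST)).map_of_exact (ev w)).isIso_f_iff.1
    (isIso_spanMap_app F hST hw)

variable [∀ x, Mono (phiMap F x)]

instance (S : Set Q) (x : Q) : Mono (phiMap (span (gen F) S) x) := mono_phi_of_mono (spanι _ _) x

/-- By the snake argument it suffices that `cok x` keeps the inclusion mono. For `x ∈ S` both spans
agree with `F` at `x` and its predecessors; for `x ∉ S` the source is zero. -/
lemma mono_phiMap_layer (hS : ∀ x ∈ S, ∀ w, (w ⟶ x) → w ∈ S) (x : Q) :
    Mono (phiMap (cokernel (spanMap (gen F) hST)) x) := by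
  have h := shortExact_cokernel (spanMap (gen F) hST)
  have : Mono (phiMap (ShortComplex.mk _ _ (cokernel.condition (spanMap (gen F) hST))).X₂ x) :=
    inferInstanceAs (Mono (phiMap (span (gen F) T) x))
  have : Mono ((cok x).map (spanMap (gen F) hST)) := by
    by_cases hx : x ∈ S
    · have := isIso_spanMap_app F hST hx
      have := isIso_inc_map (spanMap (gen F) hST) x
        (fun w a ↦ isIso_spanMap_app F hST (hS x hx w a))
      have := isIso_cok_map (spanMap (gen F) hST) x
      infer_instance
    · exact Preadditive.mono_of_cancel_zero _
        (fun _ _ ↦ (isZero_cok_span F S hx).eq_of_tgt _ _)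
  exact mono_phi_of_mono_cok_map h x

/-- The layer `K` has `cok` concentrated at `v`, where it is that of `F`. Predecessors of `v` lie in
`S`, where `K` vanishes, so `K(v)` is its own cokernel, and the map `f_v(K(v)) ⟶ K` is invertible
because it is so on every `cok w`. -/
lemma exists_iso_layer (hQ : IsLeftRooted Q) (hT : ∀ x ∈ T, ∀ w, (w ⟶ x) → w ∈ S) {v : Q}
    (hvT : v ∈ T) (hvS : v ∉ S) (hv : ∀ w ∈ T, w ≠ v → w ∈ S) :
    Nonempty (cokernel (spanMap (gen F) hST) ≅ (freeAt v).obj ((cok v).obj F)) := by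
  have hmono := mono_phiMap_layer F hST (fun x hx ↦ hT x (hST hx))
  have hzero {w : Q} (hw : w ∈ S) := isZero_layer_of_mem F hST hw
  have hcok {w : Q} (hw : w ≠ v) : IsZero ((cok w).obj (cokernel (spanMap (gen F) hST))) := by
    by_cases hw' : w ∈ S
    · exact IsZero.of_epi (cokπ _ w) (hzero hw')
    · exact IsZero.of_epi ((cok w).map (cokernel.π (spanMap (gen F) hST)))
        (isZero_cok_span F T (fun h ↦ hw' (hv w h hw)))
  have h₁ : IsIso ((cok v).map (cokernel.π (spanMap (gen F) hST))) := by
    have h := (shortExact_cokernel (spanMap (gen F) hST)).exact.map_of_epi_of_preservesCokernel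
      (cok v) inferInstance inferInstance
    have : Mono ((cok v).map (cokernel.π (spanMap (gen F) hST))) :=
      h.mono_g ((isZero_cok_span F S hvS).eq_of_src _ _)
    exact isIso_of_mono_of_epi _
  have h₂ : IsIso ((cok v).map (spanι (gen F) T)) := by
    have := isIso_spanι_app F T hvT
    have := isIso_inc_map (spanι (gen F) T) v
      (fun w a ↦ isIso_spanι_app F T (hST (hT v hvT w a)))
    exact isIso_cok_map _ _
  have e : (cok v).obj (cokernel (spanMap (gen F) hST)) ≅ (cok v).obj F :=
    (asIso ((cok v).map (cokernel.π (spanMap (gen F) hST)))).symm ≪≫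
      asIso ((cok v).map (spanι (gen F) T))
  clear h₁ h₂
  generalize cokernel (spanMap (gen F) hST) = K at *
  have h₃ : IsIso (cokπ K v) := by
    have : phiMap K v = 0 :=
      inc_hom_ext (fun w a ↦ (hzero (hT v hvT w a)).eq_of_src _ _)
    obtain ⟨g, hg⟩ := exists_cok_desc (F := K) (x := v) (𝟙 _) (by rw [this, zero_comp])
    exact ⟨g, hg, by rw [← cancel_epi (cokπ K v), reassoc_of% hg, Category.comp_id]⟩
  have h₄ (w : Q) : IsIso ((cok w).map (gen K v)) := by
    by_cases hw : w = v
    · subst hw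
      have h := isIso_cokπ_freeAt w (K.obj ((Paths.of Q).obj w))
      have : (ιFree _ (𝟙 ((Paths.of Q).obj w)) ≫ cokπ ((freeAt w).obj _) w) ≫
          (cok w).map (gen K w) = cokπ K w := by
        rw [Category.assoc, cokπ_map, ← Category.assoc, ιFree_gen, Category.id_comp]
      exact IsIso.of_isIso_fac_left this
    · exact isIso_of_source_target_iso_zero _
        (isZero_cok_freeAt (Ne.symm hw) _).isoZero (hcok hw).isoZero
  have := isIso_of_isIso_cok_map hQ (gen K v)
  exact ⟨(asIso (gen K v)).symm ≪≫ (freeAt v).mapIso (asIso (cokπ K v) ≪≫ e)⟩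

end Layer

end Generators

end QuiverRep

end

/-! ### The class `Φ(X)`, filtrations and direct summands. -/

noncomputable section

namespace QuiverRep

attribute [-instance] catToReflQuiver

section Chains

variable {C : Type u} [Category.{v} C] [Abelian C] [HasColimits C] [AB5 C]

/-- Needed for the image of a filtration under `cok x`, which is not left exact: monomorphy is known
at successors and passes to limit stages by AB5. -/
lemma mono_map_of_mono_succ {J : Type v} [LinearOrder J] [SuccOrder J] [WellFoundedLT J]
    (F : J ⥤ C) [F.IsWellOrderContinuous]
    (h : ∀ j, ¬ IsMax j → Mono (F.map (homOfLE (Order.le_succ j)))) {i j : J} (f : i ⟶ j) :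
    Mono (F.map f) := by
  induction j using SuccOrder.limitRecOn generalizing i with
  | isMin j hj =>
    obtain rfl := hj.eq_of_le (leOfHom f)
    have : f = 𝟙 _ := Subsingleton.elim _ _
    rw [this]
    infer_instance
  | succ j hj hj' =>
    obtain hij | hij := (leOfHom f).lt_or_eq
    · have := h j hj
      have := hj' (homOfLE (Order.le_of_lt_succ hij))
      have e : f = homOfLE (Order.le_of_lt_succ hij) ≫ homOfLE (Order.le_succ j) :=
        Subsingleton.elim _ _
      rw [e, F.map_comp]
      infer_instance
    · subst hij
      have : f = 𝟙 _ := Subsingleton.elim _ _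
      rw [this]
      infer_instance
  | isSuccLimit j hj hj' =>
    obtain hij | hij := (leOfHom f).lt_or_eq
    · have : Nonempty (Set.Iio j) := ⟨⟨i, hij⟩⟩
      let G := (Set.principalSegIio j).monotone.functor ⋙ F
      have hG (a b : Set.Iio j) (g : a ⟶ b) : Mono (G.map g) := hj' b.1 b.2 _
      exact (F.isColimitOfIsWellOrderContinuous j hj).mono_ι_app_of_isFiltered ⟨i, hij⟩
    · subst hij
      have : f = 𝟙 _ := Subsingleton.elim _ _
      rw [this]
      infer_instance

end Chains

section Classes

variable {Q : Type v} [Quiver.{v} Q] {A : Type u} [Category.{v} A] [HasColimits A]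

lemma fStar_mono {X Y : ObjectProperty A} (h : X ≤ Y) :
    (fStar X : ObjectProperty (Rep Q A)) ≤ fStar Y := by
  rintro F ⟨v, M, hM, e⟩
  exact ⟨v, M, h _ hM, e⟩

lemma fStar_freeAt {X : ObjectProperty A} (x : Q) {M : A} (hM : X M) :
    fStar X ((freeAt x).obj M) := ⟨x, M, hM, ⟨Iso.refl _⟩⟩

variable [Abelian A]

lemma Phi.mono {X Y : ObjectProperty A} (h : X ≤ Y) : (Phi X : ObjectProperty (Rep Q A)) ≤ Phi Y :=
  fun _ hF x ↦ ⟨(hF x).1, ObjectProperty.monotone_isoClosure h _ (hF x).2⟩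

variable [AB5 A]

instance : AB5 (Rep Q A) := ⟨fun _ _ _ ↦ inferInstance⟩

instance (X : ObjectProperty A) : (Phi X : ObjectProperty (Rep Q A)).IsClosedUnderIsomorphisms where
  of_iso {F G} e hF x := by
    have : Mono (phiMap F x) := (hF x).1
    exact ⟨mono_phi_of_mono e.inv x, X.isoClosure.prop_of_iso ((cok x).mapIso e) (hF x).2⟩

lemma Phi.of_retract {X : ObjectProperty A} [X.IsStableUnderRetracts] {F G : Rep Q A}
    (hG : Phi X G) (r : Retract F G) : Phi X F := by
  intro x
  have : Mono (phiMap G x) := (hG x).1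
  have : Mono r.i := SplitMono.mono ⟨r.r, r.retract⟩
  have h := (hG x).2
  rw [ObjectProperty.isoClosure_eq_self] at h ⊢
  exact ⟨mono_phi_of_mono r.i x, X.prop_of_retract (r.map (cok x)) h⟩

/-- `f_v(Y)` has zero cokernel at all vertices other than `v`, whence the need for a zero object in
`X`. -/
lemma fStar_le_phi {X : ObjectProperty A} (hX : X.ContainsZero) :
    (fStar X : ObjectProperty (Rep Q A)) ≤ Phi X := by
  rintro F ⟨v, Y, hY, ⟨e⟩⟩
  refine ObjectProperty.prop_of_iso _ e.symm (fun x ↦ ⟨inferInstanceAs (Mono (phiMap _ _)), ?_⟩)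
  by_cases h : v = x
  · subst h
    have := isIso_cokπ_freeAt v Y
    exact ⟨Y, hY, ⟨(asIso (ιFree Y (𝟙 ((Paths.of Q).obj v)) ≫ cokπ ((freeAt v).obj Y) v)).symm⟩⟩
  · obtain ⟨Z, hZ, hZ'⟩ := hX
    exact ⟨Z, hZ', ⟨(isZero_cok_freeAt h Y).iso hZ⟩⟩

lemma mono_phiMap_of_isColimit {J : Type v} [Category.{v} J] [HasExactColimitsOfShape J A]
    {D : J ⥤ Rep Q A} {c : Cocone D} (hc : IsColimit c) (x : Q)
    (h : ∀ j, Mono (phiMap (D.obj j) x)) : Mono (phiMap c.pt x) := by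
  have (j : J) : Mono ((Functor.whiskerLeft D (phiNat x)).app j) := h j
  have := NatTrans.mono_of_mono_app (Functor.whiskerLeft D (phiNat x))
  exact colim.map_mono' (Functor.whiskerLeft D (phiNat x)) (isColimitOfPreserves (inc x) hc)
    (isColimitOfPreserves (ev x) hc) (phiMap c.pt x) (fun j ↦ inc_naturality (c.ι.app j) x)

/-- Every object of `Φ(X)` is `f_*(X)`-filtered. -/
lemma phi_le_filt (hQ : IsLeftRooted Q) (X : ObjectProperty A) :
    (Phi X : ObjectProperty (Rep Q A)) ≤ Filt (fStar X) := by
  intro F hF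
  have hm (x : Q) : Mono (phiMap F x) := (hF x).1
  choose Y hY e using fun x ↦ (hF x).2
  let r (w x : Q) : Prop := Nonempty (w ⟶ x)
  have : IsWellFounded Q r := ⟨isLeftRooted_wellFounded hQ⟩
  -- A well-order in which every arrow goes strictly upwards, obtained from ranks.
  obtain ⟨o, ho, hr⟩ : ∃ o : LinearOrder Q, WellFoundedLT Q ∧ ∀ w x, r w x → o.lt w x :=
    ⟨IsWellFounded.wellOrderExtension r, IsWellFounded.wellOrderExtension.isWellFounded_lt r,
      fun _ _ h ↦ Prod.Lex.left _ _ (IsWellFounded.rank_lt_of_rel h)⟩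
  refine (Stages.ofGenerators (gen F) (isIso_of_fac_gen F)).filt (fun v ↦ ?_)
  obtain ⟨e'⟩ := exists_iso_layer F (Set.Iio_subset_Iic_self (a := v)) hQ
    (fun x hx w a ↦ lt_of_lt_of_le (hr w x ⟨a⟩) hx) Set.self_mem_Iic (lt_irrefl v)
    (fun w hw hwv ↦ lt_of_le_of_ne hw hwv)
  exact ⟨v, Y v, hY v, ⟨e' ≪≫ (freeAt v).mapIso (e v).some⟩⟩

/-- `φ_x` stays mono under extensions and filtered colimits, hence along the whole filtration. Since
the layers have mono `φ_x`, applying `cok x` gives a continuous chain of monomorphisms with layers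
in `X`. -/
lemma filt_phi_le (X : ObjectProperty A) :
    (Filt (Phi X) : ObjectProperty (Rep Q A)) ≤ Phi (Filt X) := by
  rintro M ⟨J, i₁, i₂, i₃, i₄, i₅, F, hF, bot, hF', layer, ⟨e⟩⟩
  refine ObjectProperty.prop_of_iso _ e (fun x ↦ ?_)
  have hF {i j : J} (f : i ⟶ j) : Mono (F.map f) := hF i j (leOfHom f)
  rw [ObjectProperty.isoClosure_eq_self] at layer
  have hlayer (j : J) (hj : ¬ IsMax j) :
      Mono (phiMap (cokernel (F.map (homOfLE (Order.le_succ j)))) x) := (layer j hj x).1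
  have hphi (j : J) : Mono (phiMap (F.obj j) x) := by
    induction j using SuccOrder.limitRecOn with
    | isMin j hj =>
      obtain rfl := hj.eq_bot
      have : IsZero ((inc x).obj (F.obj ⊥)) := (inc x).map_isZero bot
      exact Preadditive.mono_of_cancel_zero _ (fun _ _ ↦ this.eq_of_tgt _ _)
    | succ j hj h =>
      have := hlayer j hj
      have h₁ := Stages.shortExact_cokernel (F.map (homOfLE (Order.le_succ j)))
      have : Mono (phiMap (ShortComplex.mk _ _
        (cokernel.condition (F.map (homOfLE (Order.le_succ j))))).X₁ x) := h
      have : Mono (phiMap (ShortComplex.mk _ _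
        (cokernel.condition (F.map (homOfLE (Order.le_succ j))))).X₃ x) := hlayer j hj
      exact mono_phi_of_shortExact h₁ x
    | isSuccLimit j hj h =>
      have : Nonempty (Set.Iio j) := ⟨⟨⊥, hj.bot_lt⟩⟩
      exact mono_phiMap_of_isColimit (F.isColimitOfIsWellOrderContinuous j hj) x
        (fun i ↦ h i.1 i.2)
  have : (F ⋙ cok x).IsWellOrderContinuous :=
    ⟨fun m hm ↦ ⟨isColimitOfPreserves (cok x) (F.isColimitOfIsWellOrderContinuous m hm)⟩⟩
  have hsucc (j : J) (hj : ¬ IsMax j) :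
      Mono ((F ⋙ cok x).map (homOfLE (Order.le_succ j))) := by
    have : Mono (phiMap (ShortComplex.mk _ _
      (cokernel.condition (F.map (homOfLE (Order.le_succ j))))).X₃ x) := hlayer j hj
    exact mono_cok_map (Stages.shortExact_cokernel (F.map (homOfLE (Order.le_succ j)))) x
  refine ⟨hphi ⊤, ObjectProperty.le_isoClosure _ _ ⟨J, i₁, i₂, i₃, i₄, i₅, F ⋙ cok x,
    fun i j h ↦ mono_map_of_mono_succ _ hsucc _, (cok x).map_isZero bot, this, fun j hj ↦ ?_,
    ⟨Iso.refl _⟩⟩⟩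
  exact X.isoClosure.prop_of_iso (PreservesCokernel.iso (cok x) _) (layer j hj x).2

lemma filt_containsZero (X : ObjectProperty A) : (Filt X).ContainsZero :=
  ⟨_, isZero_zero A, filt_of_isZero X (isZero_zero A)⟩

lemma fStar_filt_le (X : ObjectProperty A) :
    (fStar (Filt X) : ObjectProperty (Rep Q A)) ≤ Filt (fStar X) := by
  rintro F ⟨x, M, hM, ⟨e⟩⟩
  exact (filt_map (freeAdj x) (fun _ h ↦ le_filt _ _ (fStar_freeAt x h)) hM).of_iso e.symm

lemma fStar_sFilt_le (X : ObjectProperty A) :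
    (fStar (sFilt X) : ObjectProperty (Rep Q A)) ≤ sFilt (fStar X) := by
  rintro F ⟨x, M, hM, ⟨e⟩⟩
  exact (sFilt_map (freeAdj x) (fun _ h ↦ le_filt _ _ (fStar_freeAt x h)) hM).of_retract
    (Retract.ofIso e)

/-- Summing over all vertices gives the cokernel `Y` at each of them, so no zero object is needed;
each `f_x(Y)` is then a summand of an object of `Φ(X)`. -/
lemma phi_coproduct_freeAt {X : ObjectProperty A} {Y : A} (hY : X Y) :
    Phi X (∐ fun x : Q ↦ (freeAt x).obj Y) := by
  classical
  have : HasFiniteBiproducts A := Abelian.hasFiniteBiproducts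
  have : AB4 A := AB4.of_AB5 (C := A)
  intro x
  refine ⟨mono_phiMap_of_isColimit (coproductIsCoproduct fun x : Q ↦ (freeAt x).obj Y) x
    (fun ⟨w⟩ ↦ inferInstanceAs (Mono (phiMap ((freeAt w).obj Y) x))), Y, hY, ⟨Iso.symm ?_⟩⟩
  have h₁ := isIso_cokπ_freeAt x Y
  have : Mono ((cok x).map (Sigma.ι (fun x : Q ↦ (freeAt x).obj Y) x)) :=
    SplitMono.mono ⟨(cok x).map (Sigma.π _ x), by rw [← Functor.map_comp]; simp⟩
  have : Epi ((cok x).map (Sigma.ι (fun x : Q ↦ (freeAt x).obj Y) x)) := by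
    refine ⟨fun f g hfg ↦ (isColimitOfPreserves (cok (A := A) x)
      (coproductIsCoproduct fun x : Q ↦ (freeAt x).obj Y)).hom_ext (fun ⟨w⟩ ↦ ?_)⟩
    by_cases h : w = x
    · subst h
      exact hfg
    · exact (isZero_cok_freeAt h Y).eq_of_src _ _
  have h₂ := isIso_of_mono_of_epi ((cok x).map (Sigma.ι (fun x : Q ↦ (freeAt x).obj Y) x))
  exact asIso (ιFree Y (𝟙 ((Paths.of Q).obj x)) ≫ cokπ ((freeAt x).obj Y) x) ≪≫
    @asIso _ _ _ _ _ h₂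

lemma fStar_le_sFilt_phi (X : ObjectProperty A) :
    (fStar X : ObjectProperty (Rep Q A)) ≤ sFilt (Phi X) := by
  classical
  rintro F ⟨x, Y, hY, ⟨e⟩⟩
  refine (le_sFilt _ _ (phi_coproduct_freeAt hY)).of_retract
    ((Retract.ofIso e).trans ⟨Sigma.ι (fun x : Q ↦ (freeAt x).obj Y) x, Sigma.π _ x, by simp⟩)

instance (X : ObjectProperty A) : (sFilt X).IsStableUnderRetracts := ⟨fun r h ↦ h.of_retract r⟩

/-- `Filt X` contains zero, so `f_*(X)` lies in `Φ(Filt X)`, which is closed under filtrations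
because `Filt` is idempotent. -/
lemma filt_fStar_le (X : ObjectProperty A) :
    (Filt (fStar X) : ObjectProperty (Rep Q A)) ≤ Phi (Filt X) := by
  have h := filt_phi_le (Q := Q) (Filt X)
  rw [filt_filt] at h
  exact (Filt.mono ((fStar_mono (le_filt X)).trans (fStar_le_phi (filt_containsZero X)))).trans h

lemma phi_filt (hQ : IsLeftRooted Q) (X : ObjectProperty A) :
    (Phi (Filt X) : ObjectProperty (Rep Q A)) = Filt (fStar X) := by
  refine le_antisymm ?_ (filt_fStar_le X)
  refine (phi_le_filt hQ _).trans ?_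
  rw [← filt_filt (fStar X)]
  exact Filt.mono (fStar_filt_le X)

lemma phi_eq_filt_sums (hQ : IsLeftRooted Q) {X : ObjectProperty A} (hX : Filt X ≤ X) :
    (Phi X : ObjectProperty (Rep Q A)) = Filt (sums (fStar X)) := by
  refine le_antisymm ((phi_le_filt hQ X).trans (Filt.mono (le_sums _))) ?_
  refine (Filt.mono (sums_le_filt _)).trans ?_
  rw [filt_filt]
  exact (filt_fStar_le X).trans (Phi.mono hX)

lemma phi_sFilt (hQ : IsLeftRooted Q) (X : ObjectProperty A) :
    (Phi (sFilt X) : ObjectProperty (Rep Q A)) = sFilt (fStar X) := by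
  refine le_antisymm ?_ (fun F hF ↦ ?_)
  · exact (phi_le_filt hQ _).trans ((Filt.mono (fStar_sFilt_le X)).trans (filt_sFilt_le _))
  · obtain ⟨G, r, hG⟩ := (sFilt_iff_retract _ _).1 hF
    exact Phi.of_retract (Phi.mono (filt_le_sFilt X) _ (filt_fStar_le X _ hG)) r

lemma sFilt_fStar (hQ : IsLeftRooted Q) (X : ObjectProperty A) :
    (sFilt (fStar X) : ObjectProperty (Rep Q A)) = sFilt (Phi X) := by
  refine le_antisymm ?_ ?_
  · rw [← sFilt_sFilt (Phi X)]
    exact sFilt.mono (fStar_le_sFilt_phi X)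
  · rintro F ⟨G, hG⟩
    exact ⟨G, (phi_filt hQ X).le _ (filt_phi_le X _ hG)⟩

end Classes

end QuiverRep

end

/-! ### Extensions and `Ext^1`. -/

noncomputable section

namespace QuiverRep

attribute [-instance] catToReflQuiver

attribute [local simp] pullback.lift_fst pullback.lift_fst_assoc pullback.lift_snd
  pullback.lift_snd_assoc pushout.inl_desc pushout.inl_desc_assoc pushout.inr_desc
  pushout.inr_desc_assoc

section ShortExact

variable {C : Type u} [Category.{v} C] [Abelian C] {A E X : C} {f : A ⟶ E} {g : E ⟶ X}
  {w : f ≫ g = 0} (h : (ShortComplex.mk f g w).ShortExact)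

include h

lemma exists_shortExact_pullback {X' : C} (a : X' ⟶ X) :
    ∃ (E' : C) (f' : A ⟶ E') (g' : E' ⟶ X') (w' : f' ≫ g' = 0) (m : E' ⟶ E),
      (ShortComplex.mk f' g' w').ShortExact ∧ f' ≫ m = f ∧ m ≫ g = g' ≫ a := by
  have := h.mono_f
  have : Epi g := h.epi_g
  have hl : pullback.lift f 0 (by simp [w]) ≫ pullback.fst g a = f := pullback.lift_fst _ _ _
  have : Mono (pullback.lift (f := g) (g := a) f 0 (by simp [w])) := by
    have : Mono f := h.mono_f
    exact mono_of_mono_fac hl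
  refine ⟨pullback g a, pullback.lift f 0 _, pullback.snd _ _, pullback.lift_snd _ _ _,
    pullback.fst _ _, shortExact_of_fac _ _ _ (fun T x hx ↦ ?_), hl, pullback.condition⟩
  obtain ⟨k, hk⟩ := fac_of_shortExact h (x ≫ pullback.fst _ _)
    (by rw [Category.assoc, pullback.condition, reassoc_of% hx, zero_comp])
  exact ⟨k, by apply pullback.hom_ext <;> simp [hk, hx]⟩

lemma shortExact_pushout {A' : C} (a : A ⟶ A') :
    (ShortComplex.mk (pushout.inr f a) (pushout.desc g 0 (by simp [w])) (by simp)).ShortExact := by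
  have : Mono f := h.mono_f
  have : Epi g := h.epi_g
  have hg : pushout.inl f a ≫ pushout.desc g 0 (by simp [w]) = g := pushout.inl_desc _ _ _
  have : Epi (pushout.desc (f := f) (g := a) g 0 (by simp [w])) := epi_of_epi_fac hg
  refine ShortComplex.ShortExact.mk' (ShortComplex.exact_of_g_is_cokernel _ ?_) inferInstance
    inferInstance
  have key {Z : C} (k : pushout f a ⟶ Z) (hk : pushout.inr f a ≫ k = 0) :
      ∃ l : X ⟶ Z, pushout.desc g 0 (by simp [w]) ≫ l = k := by
    refine ⟨h.exact.desc (pushout.inl f a ≫ k) ?_, ?_⟩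
    · exact (pushout.condition_assoc k).trans (by rw [hk, comp_zero])
    · apply pushout.hom_ext
      · simpa using h.exact.g_desc _ _
      · simp [hk]
  exact CokernelCofork.IsColimit.ofπ _ _ (fun k hk ↦ (key k hk).choose)
    (fun k hk ↦ (key k hk).choose_spec)
    (fun k hk m hm ↦ (cancel_epi _).1 (hm.trans (key k hk).choose_spec.symm))

lemma exists_shortExact_pushout {A' : C} (a : A ⟶ A') :
    ∃ (E' : C) (f' : A' ⟶ E') (g' : E' ⟶ X) (w' : f' ≫ g' = 0) (m : E ⟶ E'),
      (ShortComplex.mk f' g' w').ShortExact ∧ f ≫ m = a ≫ f' ∧ m ≫ g' = g :=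
  ⟨_, _, _, _, pushout.inl _ _, shortExact_pushout h a, pushout.condition, pushout.inl_desc _ _ _⟩

section

variable {A' E' : C} {f' : A' ⟶ E'} {g' : E' ⟶ X} {w' : f' ≫ g' = 0}
  (h' : (ShortComplex.mk f' g' w').ShortExact) {a : A ⟶ A'} {m : E ⟶ E'} (hf : f ≫ m = a ≫ f')
  (hg : m ≫ g' = g)

include h' hf hg

/-- A morphism of extensions which is the identity on the quotient exhibits its target as a pushout,
by the five lemma. -/
lemma exists_desc_of_shortExact {Z : C} (u : A' ⟶ Z) (b : E ⟶ Z) (hub : f ≫ b = a ≫ u) :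
    ∃ d : E' ⟶ Z, f' ≫ d = u ∧ m ≫ d = b := by
  have hP := shortExact_pushout h a
  let p : pushout f a ⟶ E' := pushout.desc m f' hf
  let φ : ShortComplex.mk (pushout.inr f a) (pushout.desc g 0 (by simp [w])) (by simp) ⟶
      ShortComplex.mk f' g' w' :=
    { τ₁ := 𝟙 _
      τ₂ := p
      τ₃ := 𝟙 _
      comm₁₂ := by simp [p]
      comm₂₃ := by apply pushout.hom_ext <;> simp [p, hg, w'] }
  have : IsIso φ.τ₁ := inferInstanceAs (IsIso (𝟙 _))
  have : IsIso φ.τ₃ := inferInstanceAs (IsIso (𝟙 _))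
  have : IsIso p := ShortComplex.isIso₂_of_shortExact_of_isIso₁₃ φ hP h'
  refine ⟨inv p ≫ pushout.desc b u hub, ?_, ?_⟩
  · have : f' ≫ inv p = pushout.inr f a := by rw [IsIso.comp_inv_eq]; simp [p]
    rw [reassoc_of% this, pushout.inr_desc]
  · have : m ≫ inv p = pushout.inl f a := by rw [IsIso.comp_inv_eq]; simp [p]
    rw [reassoc_of% this, pushout.inl_desc]

lemma hom_ext_of_shortExact {Z : C} {d d' : E' ⟶ Z} (h₁ : f' ≫ d = f' ≫ d')
    (h₂ : m ≫ d = m ≫ d') : d = d' := by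
  have : Epi g := h.epi_g
  have : Epi (ShortComplex.mk f' g' w').g := h'.epi_g
  have h₃ : f' ≫ (d - d') = 0 := by rw [Preadditive.comp_sub, h₁, sub_self]
  have h₄ : g' ≫ h'.exact.desc (d - d') h₃ = d - d' := h'.exact.g_desc _ _
  have h₅ : h'.exact.desc (d - d') h₃ = 0 := by
    rw [← cancel_epi g, ← hg, Category.assoc, h₄, Preadditive.comp_sub, h₂, sub_self]
    simp
  rw [← sub_eq_zero, ← h₄, h₅, comp_zero]

end

end ShortExact

section Ext

open Abelian

universe w'

variable {C : Type u} [Category.{v} C] [Abelian C] [HasExt.{w'} C]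

/-- The obstruction to lifting `S.g ≫ b` through `T.g` vanishes by `h`, which gives some `m`; the
map induced on subobjects must then be corrected. -/
lemma exists_map_of_extClass {S T : ShortComplex C} (hS : S.ShortExact) (hT : T.ShortExact)
    (a : S.X₁ ⟶ T.X₁) (b : S.X₃ ⟶ T.X₃)
    (h : hS.extClass.comp (Ext.mk₀ a) (add_zero 1) = (Ext.mk₀ b).comp hT.extClass (zero_add 1)) :
    ∃ m : S.X₂ ⟶ T.X₂, S.f ≫ m = a ≫ T.f ∧ m ≫ T.g = S.g ≫ b := by
  have := hT.mono_f
  obtain ⟨x, hx⟩ := Ext.covariant_sequence_exact₃ S.X₂ hT (Ext.mk₀ (S.g ≫ b)) (zero_add 1) (by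
    rw [← Ext.mk₀_comp_mk₀, Ext.comp_assoc_of_second_deg_zero, ← h, ← Ext.comp_assoc (a₁₂ := 1),
      hS.comp_extClass, Ext.zero_comp] <;> rfl)
  obtain ⟨m, rfl⟩ := (Ext.mk₀_bijective _ _).2 x
  rw [Ext.mk₀_comp_mk₀] at hx
  have hm : m ≫ T.g = S.g ≫ b := (Ext.mk₀_bijective _ _).1 hx
  let a' := hT.exact.lift (S.f ≫ m) (by rw [Category.assoc, hm, S.zero_assoc, zero_comp])
  have ha' : a' ≫ T.f = S.f ≫ m := hT.exact.lift_f _ _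
  let φ : S ⟶ T := { τ₁ := a', τ₂ := m, τ₃ := b, comm₁₂ := ha', comm₂₃ := hm }
  have hφ := ShortComplex.ShortExact.extClass_naturality hS hT φ
  -- `a - a'` annihilates the class of `S`, so it extends to `t` on `S.X₂`; adding `t ≫ T.f` to `m`
  -- repairs the left square.
  obtain ⟨y, hy⟩ := Ext.contravariant_sequence_exact₁ hS T.X₁ (Ext.mk₀ (a - a')) (add_zero 1) (by
    rw [sub_eq_add_neg, Ext.mk₀_add, Ext.comp_add, Ext.mk₀_neg, Ext.comp_neg, h]
    exact add_neg_eq_zero.2 hφ.symm)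
  obtain ⟨t, rfl⟩ := (Ext.mk₀_bijective _ _).2 y
  rw [Ext.mk₀_comp_mk₀] at hy
  have ht : S.f ≫ t = a - a' := (Ext.mk₀_bijective _ _).1 hy
  refine ⟨m + t ≫ T.f, ?_, by simp [hm]⟩
  rw [Preadditive.comp_add, reassoc_of% ht, Preadditive.sub_comp, ha']
  abel

/-- The class dies in `Ext^1` into an injective, hence comes from a map of `X` to the cokernel of
the injective embedding; pull back along it. -/
lemma exists_shortExact_extClass [EnoughInjectives C] {X Y : C} (e : Ext X Y 1) :
    ∃ (E : C) (f : Y ⟶ E) (g : E ⟶ X) (w : f ≫ g = 0)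
      (h : (ShortComplex.mk f g w).ShortExact), h.extClass = e := by
  have hS := Stages.shortExact_cokernel (Injective.ι Y)
  obtain ⟨x, hx⟩ := Ext.covariant_sequence_exact₁ X hS e (Ext.eq_zero_of_injective _) (zero_add 1)
  obtain ⟨b, rfl⟩ := (Ext.mk₀_bijective _ _).2 x
  obtain ⟨E, f, g, w, m, h, h₁, h₂⟩ := exists_shortExact_pullback hS b
  refine ⟨E, f, g, w, h, ?_⟩
  let φ : ShortComplex.mk f g w ⟶ ShortComplex.mk _ _ (cokernel.condition (Injective.ι Y)) :=
    { τ₁ := 𝟙 _, τ₂ := m, τ₃ := b, comm₁₂ := by simp [h₁], comm₂₃ := h₂ }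
  rw [← hx]
  have := ShortComplex.ShortExact.extClass_naturality h hS φ
  exact (Ext.comp_mk₀_id _).symm.trans this

end Ext

end QuiverRep

end

/-! ### `FP_2` in terms of short exact sequences. -/

noncomputable section

namespace QuiverRep

attribute [-instance] catToReflQuiver

section Separator

lemma hasSeparator_of_isLocallyFinitelyPresentable (C : Type u) [Category.{v} C] [Abelian C]
    [IsLocallyFinitelyPresentable.{v} C] : HasSeparator C := by
  have := Cardinal.fact_isRegular_aleph0.{v}
  obtain ⟨P, hP, hP'⟩ := HasCardinalFilteredGenerator.exists_small_generator.{v} C Cardinal.aleph0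
  let e := equivShrink.{v} (Subtype P)
  have hsep : ObjectProperty.IsSeparating (.ofObj fun i ↦ (e.symm i).1) :=
    hP'.isStrongGenerator.isSeparating.of_le (fun G hG ↦ by
      have := ObjectProperty.ofObj_apply (fun i ↦ (e.symm i).1) (e ⟨G, hG⟩)
      simpa using this)
  exact ⟨_, hsep.isSeparator_coproduct⟩

lemma enoughInjectives_of_isLocallyFinitelyPresentable (C : Type u) [Category.{v} C] [Abelian C]
    [IsLocallyFinitelyPresentable.{v} C] [AB5 C] : EnoughInjectives C := by
  have := hasSeparator_of_isLocallyFinitelyPresentable C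
  have : IsGrothendieckAbelian.{v} C := {}
  infer_instance

end Separator

section FPTwo

variable {C : Type u} [Category.{v} C] [Abelian C]

/-- A description of the objects `X` of type `FP_2` in terms of short exact sequences: `X` is
finitely presentable, extensions of `X` by filtered colimits descend to some stage, and an
extension of `X` by some stage which splits in the colimit splits at some later stage. -/
structure FPTwo (X : C) : Prop where
  fp : IsFinitelyPresentable.{v} X
  exists_extension {J : Type v} [SmallCategory J] [IsFiltered J] {D : J ⥤ C} {c : Cocone D}
    (hc : IsColimit c) {E : C} {f : c.pt ⟶ E} {g : E ⟶ X} {w : f ≫ g = 0}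
    (h : (ShortComplex.mk f g w).ShortExact) :
    ∃ (j : J) (E' : C) (f' : D.obj j ⟶ E') (g' : E' ⟶ X) (w' : f' ≫ g' = 0) (m : E' ⟶ E),
      (ShortComplex.mk f' g' w').ShortExact ∧ f' ≫ m = c.ι.app j ≫ f ∧ m ≫ g = g'
  exists_extend {J : Type v} [SmallCategory J] [IsFiltered J] {D : J ⥤ C} {c : Cocone D}
    (hc : IsColimit c) {j : J} {E : C} {f : D.obj j ⟶ E} {g : E ⟶ X} {w : f ≫ g = 0}
    (h : (ShortComplex.mk f g w).ShortExact) (r : E ⟶ c.pt) (hr : f ≫ r = c.ι.app j) :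
    ∃ (k : J) (u : j ⟶ k) (r' : E ⟶ D.obj k), f ≫ r' = D.map u

section

open Abelian

attribute [local instance] HasExt.standard

variable [HasColimits C]

lemma preservesFilteredColimits_extFunctorObj {X : C} {n k : ℕ} (hX : FP n X) (hk : k < n)
    {J : Type v} [SmallCategory J] [IsFiltered J] (D : J ⥤ C) :
    PreservesColimit D (extFunctorObj X k ⋙ forget AddCommGrpCat.{max u v}) := by
  have : IsIso (colimit.post D (extFunctorObj X k)) := hX J D k hk
  have := preservesColimit_of_isIso_post (extFunctorObj X k) D
  have : PreservesFilteredColimitsOfSize.{v, v} (forget AddCommGrpCat.{max u v}) :=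
    preservesFilteredColimitsOfSize_shrink.{v, max u v, v, max u v} _
  infer_instance

lemma FP.exists_comp_eq {X : C} {n k : ℕ} (hX : FP n X) (hk : k < n)
    {J : Type v} [SmallCategory J] [IsFiltered J] {D : J ⥤ C} {c : Cocone D} (hc : IsColimit c)
    (e : Ext X c.pt k) :
    ∃ (j : J) (e' : Ext X (D.obj j) k), e'.comp (Ext.mk₀ (c.ι.app j)) (add_zero k) = e :=
  have := preservesFilteredColimits_extFunctorObj hX hk D
  Types.jointly_surjective_of_isColimit
    (isColimitOfPreserves (extFunctorObj X k ⋙ forget AddCommGrpCat.{max u v}) hc) e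

lemma FP.exists_comp_eq_comp {X : C} {n k : ℕ} (hX : FP n X) (hk : k < n)
    {J : Type v} [SmallCategory J] [IsFiltered J] {D : J ⥤ C} {c : Cocone D} (hc : IsColimit c)
    {j : J} (e e' : Ext X (D.obj j) k) (h : e.comp (Ext.mk₀ (c.ι.app j)) (add_zero k) =
      e'.comp (Ext.mk₀ (c.ι.app j)) (add_zero k)) :
    ∃ (i : J) (u : j ⟶ i), e.comp (Ext.mk₀ (D.map u)) (add_zero k) =
      e'.comp (Ext.mk₀ (D.map u)) (add_zero k) :=
  have := preservesFilteredColimits_extFunctorObj hX hk D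
  (Types.FilteredColimit.isColimit_eq_iff'
    (isColimitOfPreserves (extFunctorObj X k ⋙ forget AddCommGrpCat.{max u v}) hc) e e').1 h

end

lemma isFinitelyPresentable_of_exists {X : C}
    (h₁ : ∀ {J : Type v} [SmallCategory J] [IsFiltered J] {D : J ⥤ C} {c : Cocone D}
      (_ : IsColimit c) (f : X ⟶ c.pt), ∃ (j : J) (p : X ⟶ D.obj j), p ≫ c.ι.app j = f)
    (h₂ : ∀ {J : Type v} [SmallCategory J] [IsFiltered J] {D : J ⥤ C} {c : Cocone D}
      (_ : IsColimit c) {j : J} (p : X ⟶ D.obj j), p ≫ c.ι.app j = 0 →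
        ∃ (k : J) (u : j ⟶ k), p ≫ D.map u = 0) : IsFinitelyPresentable.{v} X := by
  rw [isFinitelyPresentable_iff_preservesFilteredColimitsOfSize]
  refine ⟨fun J _ _ ↦ ⟨fun {D} ↦ ⟨fun {c} hc ↦ ⟨?_⟩⟩⟩⟩
  refine Types.FilteredColimit.isColimitOf' _ _ (fun f ↦ ?_) (fun j x y hxy ↦ ?_)
  · obtain ⟨j, p, hp⟩ := h₁ hc f
    exact ⟨j, p, hp.symm⟩
  · change X ⟶ D.obj j at x y
    replace hxy : x ≫ c.ι.app j = y ≫ c.ι.app j := hxy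
    obtain ⟨k, u, hu⟩ := h₂ hc (x - y) (by rw [Preadditive.sub_comp, hxy, sub_self])
    rw [Preadditive.sub_comp, sub_eq_zero] at hu
    exact ⟨k, u, hu⟩

lemma exists_comp_eq_zero {X : C} [IsFinitelyPresentable.{v} X] {J : Type v} [SmallCategory J]
    [IsFiltered J] {D : J ⥤ C} {c : Cocone D} (hc : IsColimit c) {j : J} (p : X ⟶ D.obj j)
    (hp : p ≫ c.ι.app j = 0) : ∃ (k : J) (u : j ⟶ k), p ≫ D.map u = 0 := by
  obtain ⟨k, a, b, hab⟩ := IsFinitelyPresentable.exists_eq_of_isColimit hc p (0 : X ⟶ D.obj j)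
    (by rw [hp, zero_comp])
  exact ⟨k, a, by rw [hab, zero_comp]⟩

variable [HasColimits C]

/-- The three fields come from bijectivity of the comparison for `Hom`, surjectivity for `Ext^1`,
and injectivity for `Ext^1`. -/
lemma FPTwo.of_FP [EnoughInjectives C] {X : C} (hX : FP 2 X) : FPTwo X where
  fp := by
    let := HasExt.standard C
    refine isFinitelyPresentable_of_exists (fun {J _ _ D c} hc f ↦ ?_)
      (fun {J _ _ D c} hc {j} p hp ↦ ?_)
    · obtain ⟨j, e, he⟩ := hX.exists_comp_eq (k := 0) (by lia) hc (Abelian.Ext.mk₀ f)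
      obtain ⟨p, rfl⟩ := (Abelian.Ext.mk₀_bijective _ _).2 e
      rw [Abelian.Ext.mk₀_comp_mk₀] at he
      exact ⟨j, p, (Abelian.Ext.mk₀_bijective _ _).1 he⟩
    · obtain ⟨k, u, hu⟩ := hX.exists_comp_eq_comp (k := 0) (by lia) hc (Abelian.Ext.mk₀ p)
        (Abelian.Ext.mk₀ 0) (by
          rw [Abelian.Ext.mk₀_comp_mk₀, hp, Abelian.Ext.mk₀_comp_mk₀, zero_comp])
      rw [Abelian.Ext.mk₀_comp_mk₀, Abelian.Ext.mk₀_comp_mk₀] at hu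
      exact ⟨k, u, ((Abelian.Ext.mk₀_bijective _ _).1 hu).trans zero_comp⟩
  exists_extension {J _ _ D c} hc {E f g w} h := by
    let := HasExt.standard C
    obtain ⟨j, e, he⟩ := hX.exists_comp_eq (k := 1) (by lia) hc h.extClass
    obtain ⟨E', f', g', w', h', rfl⟩ := exists_shortExact_extClass e
    obtain ⟨m, hm₁, hm₂⟩ := exists_map_of_extClass h' h (c.ι.app j) (𝟙 X) (by
      rw [Abelian.Ext.mk₀_id_comp]; exact he)
    exact ⟨j, E', f', g', w', m, h', hm₁, by simpa using hm₂⟩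
  exists_extend {J _ _ D c} hc {j E f g w} h r hr := by
    let := HasExt.standard C
    obtain ⟨k, u, hu⟩ := hX.exists_comp_eq_comp (k := 1) (by lia) hc h.extClass 0 (by
      rw [Abelian.Ext.zero_comp, ← hr, ← Abelian.Ext.mk₀_comp_mk₀,
        ← Abelian.Ext.comp_assoc_of_third_deg_zero (a₁₂ := 1)]
      have : h.extClass.comp (Abelian.Ext.mk₀ f) (add_zero 1) = 0 := h.extClass_comp
      rw [this, Abelian.Ext.zero_comp])
    rw [Abelian.Ext.zero_comp] at hu
    obtain ⟨x, hx⟩ := Abelian.Ext.contravariant_sequence_exact₁ h (D.obj k)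
      (Abelian.Ext.mk₀ (D.map u)) (add_zero 1) hu
    obtain ⟨r', rfl⟩ := (Abelian.Ext.mk₀_bijective _ _).2 x
    rw [Abelian.Ext.mk₀_comp_mk₀] at hx
    exact ⟨k, u, r', (Abelian.Ext.mk₀_bijective _ _).1 hx⟩

end FPTwo

end QuiverRep

end

/-! ### Permanence of `FPTwo` and extensions of finitely presentable objects. -/

noncomputable section

namespace QuiverRep

attribute [-instance] catToReflQuiver

section Adjunction

universe u₁ u₂

variable {C : Type u₁} [Category.{v} C] {D : Type u₂} [Category.{v} D]

lemma map_comp_counit {L : C ⥤ D} {R : D ⥤ C} (adj : L ⊣ R) {M : C} {Y E : D} (x : R.obj Y ⟶ M)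
    (n : M ⟶ R.obj E) (y : Y ⟶ E) (h : x ≫ n = R.map y) :
    L.map x ≫ L.map n ≫ adj.counit.app E = adj.counit.app Y ≫ y := by
  rw [← L.map_comp_assoc, h]
  exact adj.counit.naturality y

lemma map_comp_counit_comp {L : C ⥤ D} {R : D ⥤ C} (adj : L ⊣ R) {M X : C} {E : D}
    (n : M ⟶ R.obj E) (g : E ⟶ L.obj X) (p : M ⟶ X) (h : n ≫ R.map g = p ≫ adj.unit.app X) :
    (L.map n ≫ adj.counit.app E) ≫ g = L.map p := by
  have h₁ : adj.counit.app E ≫ g = L.map (R.map g) ≫ adj.counit.app (L.obj X) :=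
    (adj.counit.naturality g).symm
  rw [Category.assoc, h₁, ← L.map_comp_assoc, h, L.map_comp, Category.assoc,
    adj.left_triangle_components, Category.comp_id]

variable [Abelian C] [Abelian D]

/-- An extension of `L.obj X` is moved to one of `X` by applying `R` and pulling back along the
unit. The property of `X` is used there, and the result is moved back by applying `L` and, to obtain
the descended extension, pushing out along the counit. -/
lemma FPTwo.leftAdjoint_obj {L : C ⥤ D} {R : D ⥤ C} (adj : L ⊣ R) [PreservesFiniteLimits L]
    [PreservesFiniteColimits R] [PreservesFilteredColimitsOfSize.{v, v} R] {X : C}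
    (hX : FPTwo X) : FPTwo (L.obj X) where
  fp := by
    have := Cardinal.fact_isRegular_aleph0.{v}
    have := hX.fp
    have : R.IsFinitelyAccessible :=
      Functor.IsFinitelyAccessible_iff_preservesFilteredColimitsOfSize.2 inferInstance
    exact adj.isCardinalPresentable_leftAdjoint_obj Cardinal.aleph0 X
  exists_extension {J _ _ F c} hc {E f g w} h := by
    have : L.IsLeftAdjoint := ⟨_, ⟨adj⟩⟩
    have : R.IsRightAdjoint := ⟨_, ⟨adj⟩⟩
    have hR := h.map_of_exact R
    obtain ⟨E₀, f₀, g₀, w₀, m₀, h₀, hf₀, hg₀⟩ := exists_shortExact_pullback hR (adj.unit.app X)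
    obtain ⟨j, E₁, f₁, g₁, w₁, m₁, h₁, hf₁, hg₁⟩ :=
      hX.exists_extension (isColimitOfPreserves R hc) h₀
    obtain ⟨E', f', g', w', p, h', hf', hg'⟩ :=
      exists_shortExact_pushout (h₁.map_of_exact L) (adj.counit.app (F.obj j))
    have h₁' := h₁.map_of_exact L
    let b : L.obj E₁ ⟶ E := L.map (m₁ ≫ m₀) ≫ adj.counit.app E
    have hb₁ : L.map f₁ ≫ b = adj.counit.app (F.obj j) ≫ c.ι.app j ≫ f :=
      map_comp_counit adj f₁ (m₁ ≫ m₀) (c.ι.app j ≫ f) (by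
        have e₁ : f₁ ≫ m₁ = R.map (c.ι.app j) ≫ f₀ := hf₁
        have e₀ : f₀ ≫ m₀ = R.map f := hf₀
        rw [reassoc_of% e₁, e₀, ← R.map_comp])
    have hb₂ : b ≫ g = L.map g₁ := map_comp_counit_comp adj _ g g₁ (by
      have e : m₀ ≫ R.map g = g₀ ≫ adj.unit.app X := hg₀
      rw [Category.assoc, e, reassoc_of% hg₁])
    obtain ⟨d, hd₁, hd₂⟩ := exists_desc_of_shortExact h₁' h' hf' hg' (c.ι.app j ≫ f) b hb₁
    refine ⟨j, E', f', g', w', d, h', hd₁, hom_ext_of_shortExact h₁' h' hf' hg' ?_ ?_⟩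
    · rw [reassoc_of% hd₁, w, comp_zero, w']
    · rw [reassoc_of% hd₂, hb₂]; exact hg'.symm
  exists_extend {J _ _ F c} hc {j E f g w} h r hr := by
    have : L.IsLeftAdjoint := ⟨_, ⟨adj⟩⟩
    have : R.IsRightAdjoint := ⟨_, ⟨adj⟩⟩
    have hR := h.map_of_exact R
    obtain ⟨E₀, f₀, g₀, w₀, m₀, h₀, hf₀, hg₀⟩ := exists_shortExact_pullback hR (adj.unit.app X)
    obtain ⟨k, u, r', hr'⟩ := hX.exists_extend (isColimitOfPreserves R hc) (j := j) h₀
      (m₀ ≫ R.map r) (by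
        have : f₀ ≫ m₀ = R.map f := hf₀
        rw [reassoc_of% this, ← R.map_comp, hr]; rfl)
    have h₀' := h₀.map_of_exact L
    obtain ⟨d, hd, -⟩ := exists_desc_of_shortExact (a := adj.counit.app (F.obj j))
      (m := L.map m₀ ≫ adj.counit.app E) h₀' h (map_comp_counit adj f₀ m₀ f hf₀)
      (map_comp_counit_comp adj m₀ g g₀ hg₀) (F.map u)
      (L.map r' ≫ adj.counit.app (F.obj k)) (map_comp_counit adj f₀ r' (F.map u) hr')
    exact ⟨k, u, d, hd⟩

end Adjunction

section Extension

variable {C : Type u} [Category.{v} C] [Abelian C] {A E X : C} {f : A ⟶ E} {g : E ⟶ X}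
  {w : f ≫ g = 0}

/-- Given `p` into a colimit, its restriction to `A` lives at a stage `j`. The pushout extension
splits in the colimit, hence at a later stage `k`; the retraction there may differ from `p` by a map
out of `X`, which lives at some stage `l`. Both are added at a common later stage. -/
lemma isFinitelyPresentable_of_shortExact (h : (ShortComplex.mk f g w).ShortExact)
    (hA : IsFinitelyPresentable.{v} A) (hX : FPTwo X) : IsFinitelyPresentable.{v} E := by
  have := hX.fp
  refine isFinitelyPresentable_of_exists (fun {J _ _ D c} hc p ↦ ?_)
    (fun {J _ _ D c} hc {j} p hp ↦ ?_)
  · obtain ⟨j, a, ha⟩ := IsFinitelyPresentable.exists_hom_of_isColimit hc (f ≫ p)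
    obtain ⟨E', f', g', w', m, h', hf', hg'⟩ := exists_shortExact_pushout h a
    obtain ⟨r, hr₁, hr₂⟩ : ∃ r : E' ⟶ c.pt, f' ≫ r = c.ι.app j ∧ m ≫ r = p :=
      exists_desc_of_shortExact h h' hf' hg' (c.ι.app j) p ha.symm
    obtain ⟨k, u, r', hr'⟩ := hX.exists_extend hc h' r hr₁
    let ι (i : J) : D.obj i ⟶ c.pt := c.ι.app i
    have h₀ : f' ≫ (r - r' ≫ ι k) = 0 := by
      have e : D.map u ≫ ι k = ι j := c.w u
      have e' : f' ≫ r = ι j := hr₁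
      rw [Preadditive.comp_sub, e', reassoc_of% hr', e, sub_self]
    have : Epi (ShortComplex.mk f' g' w').g := h'.epi_g
    let t : X ⟶ c.pt := h'.exact.desc _ h₀
    have ht : g' ≫ t = r - r' ≫ ι k := h'.exact.g_desc _ _
    obtain ⟨l, s, hs⟩ := IsFinitelyPresentable.exists_hom_of_isColimit hc t
    have w₁ : D.map (IsFiltered.leftToMax k l) ≫ ι _ = ι k := c.w _
    have w₂ : D.map (IsFiltered.rightToMax k l) ≫ ι _ = ι l := c.w _
    replace hs : s ≫ ι l = t := hs
    refine ⟨IsFiltered.max k l, m ≫ (r' ≫ D.map (IsFiltered.leftToMax k l) +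
      g' ≫ s ≫ D.map (IsFiltered.rightToMax k l)), ?_⟩
    change (m ≫ (_ + _)) ≫ ι _ = p
    simp only [Category.assoc, Preadditive.add_comp, w₁, w₂]
    rw [hs, ht, add_sub_cancel, hr₂]
  · obtain ⟨k, u, hu⟩ := exists_comp_eq_zero hc (f ≫ p) (by rw [Category.assoc, hp, comp_zero])
    rw [Category.assoc] at hu
    have hg : Epi (ShortComplex.mk f g w).g := h.epi_g
    let q : X ⟶ D.obj k := h.exact.desc _ hu
    have hq : g ≫ q = p ≫ D.map u := h.exact.g_desc _ _
    obtain ⟨l, v, hv⟩ := exists_comp_eq_zero hc q (by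
      refine hg.left_cancellation _ _ ?_
      rw [reassoc_of% hq, c.w, hp, comp_zero])
    exact ⟨l, u ≫ v, by rw [D.map_comp, ← Category.assoc, ← hq, Category.assoc, hv, comp_zero]⟩

end Extension

section Colimit

variable {C : Type u} [Category.{v} C] [Abelian C] {J : Type v} [SmallCategory J]
  [HasColimitsOfShape J C] [HasExactColimitsOfShape J C]

/-- The five lemma for colimit cocones. -/
lemma nonempty_isColimit_of_shortExact {S : ShortComplex (J ⥤ C)} (hS : S.ShortExact)
    {T : ShortComplex C} (hT : T.ShortExact) (t₁ : S.X₁ ⟶ (Functor.const J).obj T.X₁)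
    (t₂ : S.X₂ ⟶ (Functor.const J).obj T.X₂) (t₃ : S.X₃ ⟶ (Functor.const J).obj T.X₃)
    (hf : S.f ≫ t₂ = t₁ ≫ (Functor.const J).map T.f)
    (hg : S.g ≫ t₃ = t₂ ≫ (Functor.const J).map T.g)
    (h₁ : IsColimit (Cocone.mk T.X₁ t₁)) (h₃ : IsColimit (Cocone.mk T.X₃ t₃)) :
    Nonempty (IsColimit (Cocone.mk T.X₂ t₂)) := by
  have hS' := hS.map_of_exact (colim : (J ⥤ C) ⥤ C)
  let p₁ : colimit S.X₁ ⟶ T.X₁ := colimit.desc S.X₁ (Cocone.mk T.X₁ t₁)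
  let p₂ : colimit S.X₂ ⟶ T.X₂ := colimit.desc S.X₂ (Cocone.mk T.X₂ t₂)
  let p₃ : colimit S.X₃ ⟶ T.X₃ := colimit.desc S.X₃ (Cocone.mk T.X₃ t₃)
  have hp₁ (j : J) : colimit.ι S.X₁ j ≫ p₁ = t₁.app j := colimit.ι_desc _ _
  have hp₂ (j : J) : colimit.ι S.X₂ j ≫ p₂ = t₂.app j := colimit.ι_desc _ _
  have hp₃ (j : J) : colimit.ι S.X₃ j ≫ p₃ = t₃.app j := colimit.ι_desc _ _
  have h₁₂ : p₁ ≫ T.f = colimMap S.f ≫ p₂ := colimit.hom_ext fun j ↦ by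
    rw [← Category.assoc, hp₁, ι_colimMap_assoc, hp₂]
    exact (congr_app hf j).symm
  have h₂₃ : p₂ ≫ T.g = colimMap S.g ≫ p₃ := colimit.hom_ext fun j ↦ by
    rw [← Category.assoc, hp₂, ι_colimMap_assoc, hp₃]
    exact (congr_app hg j).symm
  let φ : S.map (colim : (J ⥤ C) ⥤ C) ⟶ T :=
    { τ₁ := p₁, τ₂ := p₂, τ₃ := p₃, comm₁₂ := h₁₂, comm₂₃ := h₂₃ }
  have : IsIso φ.τ₁ := ((IsColimit.nonempty_isColimit_iff_isIso_desc (colimit.isColimit _)).1 ⟨h₁⟩)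
  have : IsIso φ.τ₃ := ((IsColimit.nonempty_isColimit_iff_isIso_desc (colimit.isColimit _)).1 ⟨h₃⟩)
  have : IsIso φ.τ₂ := ShortComplex.isIso₂_of_shortExact_of_isIso₁₃ φ hS' hT
  exact (IsColimit.nonempty_isColimit_iff_isIso_desc (colimit.isColimit _)).2 this

end Colimit

end QuiverRep

end

/-! ### Extensions of direct limits as direct limits of extensions. -/

noncomputable section

namespace QuiverRep

attribute [-instance] catToReflQuiver

section Extensions

variable {C : Type u} [Category.{v} C] [Abelian C] [HasColimits C] [AB5 C] {A E X : C} {f : A ⟶ E}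
  {g : E ⟶ X} {w : f ≫ g = 0}

/-- Pull the extension back along each stage of the presentation of `X`, keeping `A` fixed. -/
lemma exists_presentation_of_presentation₃ (h : (ShortComplex.mk f g w).ShortExact) {J : Type v}
    [SmallCategory J] [IsFiltered J] (p : ColimitPresentation J X) :
    ∃ q : ColimitPresentation J E, ∀ j : J, ∃ (f' : A ⟶ q.diag.obj j)
      (g' : q.diag.obj j ⟶ p.diag.obj j) (w' : f' ≫ g' = 0),
      (ShortComplex.mk f' g' w').ShortExact := by
  have hc := h.map_of_exact (Functor.const J : C ⥤ J ⥤ C)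
  obtain ⟨G, F', G', w', M, h', h₁, h₂⟩ := exists_shortExact_pullback hc p.ι
  have := IsFiltered.isConnected J
  obtain ⟨hq⟩ := nonempty_isColimit_of_shortExact h' h (𝟙 _) M p.ι
    (h₁.trans (Category.id_comp _).symm) h₂.symm (isColimitConstCocone J A) p.isColimit
  exact ⟨⟨G, M, hq⟩, fun j ↦ ⟨F'.app j, G'.app j, congr_app w' j,
    h'.map_of_exact ((evaluation J C).obj j)⟩⟩

/-- The extension descends to one by a stage `i`; push it out along the maps to later stages. These
form `Under i`, which is final in `J`. -/
lemma exists_presentation_of_presentation₁ (h : (ShortComplex.mk f g w).ShortExact) (hX : FPTwo X)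
    {J : Type v} [SmallCategory J] [IsFiltered J] (p : ColimitPresentation J A) :
    ∃ (i : J) (q : ColimitPresentation (Under i) E), ∀ k : Under i,
      ∃ (f' : p.diag.obj k.right ⟶ q.diag.obj k) (g' : q.diag.obj k ⟶ X) (w' : f' ≫ g' = 0),
        (ShortComplex.mk f' g' w').ShortExact := by
  obtain ⟨i, E', f', g', w', m, h', hm₁, hm₂⟩ := hX.exists_extension p.isColimit h
  replace hm₁ : f' ≫ m = p.ι.app i ≫ f := hm₁
  have := IsFiltered.isConnected (Under i)
  let a : (Functor.const (Under i)).obj (p.diag.obj i) ⟶ Under.forget i ⋙ p.diag :=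
    { app k := p.diag.map k.hom
      naturality k l φ := by
        have : p.diag.map l.hom = p.diag.map k.hom ≫ p.diag.map φ.right := by
          rw [← p.diag.map_comp, Under.w]
        simpa using this }
  let t : Under.forget i ⋙ p.diag ⟶ (Functor.const (Under i)).obj A :=
    Functor.whiskerLeft (Under.forget i) p.ι
  have ht : IsColimit (Cocone.mk A t) :=
    (Functor.Final.isColimitWhiskerEquiv (Under.forget i) _).symm p.isColimit
  have hat : a ≫ t = (Functor.const (Under i)).map (p.ι.app i) := by
    ext k
    exact (p.ι.naturality k.hom).trans (Category.comp_id _)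
  have hc := h'.map_of_exact (Functor.const (Under i) : C ⥤ Under i ⥤ C)
  obtain ⟨G, F, P, wG, M, hG, h₁, h₂⟩ := exists_shortExact_pushout hc a
  have hd : (Functor.const (Under i)).map f' ≫ (Functor.const (Under i)).map m =
      a ≫ t ≫ (Functor.const (Under i)).map f := by
    rw [reassoc_of% hat, ← Functor.map_comp, ← Functor.map_comp, hm₁]
  obtain ⟨d, hd₁, hd₂⟩ := exists_desc_of_shortExact hc hG h₁ h₂ _ _ hd
  have hdP : d ≫ (Functor.const (Under i)).map g = P := by
    refine hom_ext_of_shortExact hc hG h₁ h₂ ?_ ?_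
    · rw [reassoc_of% hd₁, ← Functor.map_comp, w, Functor.map_zero, comp_zero, wG]
    · rw [reassoc_of% hd₂, ← Functor.map_comp, hm₂]
      exact h₂.symm
  obtain ⟨hq⟩ := nonempty_isColimit_of_shortExact hG h t d (𝟙 _) hd₁
    ((Category.comp_id _).trans hdP.symm) ht (isColimitConstCocone (Under i) X)
  exact ⟨i, ⟨G, d, hq⟩, fun k ↦ ⟨F.app k, P.app k, congr_app wG k,
    hG.map_of_exact ((evaluation (Under i) C).obj k)⟩⟩

/-- Extensions of filtered colimits of `FPTwo` objects `X` by filtered colimits of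
objects of a class `P` of finitely presentable objects closed under extensions by the `X`. -/
lemma dirLim_of_shortExact (h : (ShortComplex.mk f g w).ShortExact) {P T : ObjectProperty C}
    (hP : P ≤ ObjectProperty.isFinitelyPresentable.{v} C) (hT : ∀ Z, T Z → FPTwo Z)
    (hPT : ∀ {A E X : C} {f : A ⟶ E} {g : E ⟶ X} {w : f ≫ g = 0},
      (ShortComplex.mk f g w).ShortExact → P A → T X → P E)
    (hA : dirLim P A) (hX : dirLim T X) : dirLim P E := by
  obtain ⟨J, _, _, p, hp⟩ := hX
  obtain ⟨q, hq⟩ := exists_presentation_of_presentation₃ h p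
  -- `E` is a limit of extensions of the stages of `X` by `A`, and each of these a limit of
  -- extensions by stages of `A`. The iterated limit collapses since `P` consists of finitely
  -- presentable objects.
  have : dirLim (dirLim P) E := by
    refine ⟨J, inferInstance, inferInstance, q, fun j ↦ ?_⟩
    obtain ⟨f', g', w', h'⟩ := hq j
    obtain ⟨I, _, _, r, hr⟩ := hA
    obtain ⟨i, s, hs⟩ := exists_presentation_of_presentation₁ h' (hT _ (hp j)) r
    refine ⟨Under i, inferInstance, inferInstance, s, fun k ↦ ?_⟩
    obtain ⟨_, _, _, h''⟩ := hs k
    exact hPT h'' (hr _) (hp j)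
  exact (ObjectProperty.ind_ind hP).le _ this

end Extensions

end QuiverRep

end

/-! ### Induction along filtrations, and direct limits of `Φ(X)`. -/

noncomputable section

namespace QuiverRep

attribute [-instance] catToReflQuiver

section Induction

variable {C : Type u} [Category.{v} C]

lemma dirLim_isoClosure (P : ObjectProperty C) : dirLim P.isoClosure = dirLim P := by
  refine le_antisymm ?_ (fun M ⟨J, i₁, i₂, p, hp⟩ ↦ ⟨J, i₁, i₂, p, fun j ↦ P.le_isoClosure _ (hp j)⟩)
  rintro M ⟨J, i₁, i₂, p, hp⟩
  choose Y hY e using hp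
  exact ⟨J, i₁, i₂, p.changeDiag (p.diag.isoCopyObj Y fun j ↦ (e j).some).symm, hY⟩

lemma dirLim_mono {P R : ObjectProperty C} (h : P ≤ R) : dirLim P ≤ dirLim R :=
  fun _ ⟨J, i₁, i₂, p, hp⟩ ↦ ⟨J, i₁, i₂, p, fun j ↦ h _ (hp j)⟩

variable [Abelian C]

lemma filtration_induction {P R : ObjectProperty C} [R.IsClosedUnderIsomorphisms]
    (zero : ∀ Z, IsZero Z → R Z)
    (ext : ∀ {A E X : C} {f : A ⟶ E} {g : E ⟶ X} {w : f ≫ g = 0},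
      (ShortComplex.mk f g w).ShortExact → R A → P.isoClosure X → R E)
    {J : Type v} [LinearOrder J] [OrderBot J] [OrderTop J] [SuccOrder J] [WellFoundedLT J]
    (lim : ∀ F : J ⥤ C, F.IsWellOrderContinuous → ∀ m, Order.IsSuccLimit m →
      (∀ j < m, R (F.obj j)) → R (F.obj m)) {M : C} (h : HasFiltrationOfShape P J M) : R M := by
  obtain ⟨F, hF, bot, cont, layer, ⟨e⟩⟩ := h
  refine R.prop_of_iso e ?_
  generalize (⊤ : J) = j
  induction j using SuccOrder.limitRecOn with
  | isMin j hj =>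
    obtain rfl := hj.eq_bot
    exact zero _ bot
  | succ j hj h =>
    have := hF _ _ (Order.le_succ j)
    exact ext (Stages.shortExact_cokernel (F.map (homOfLE (Order.le_succ j)))) h (layer j hj)
  | isSuccLimit j hj h => exact lim F cont j hj h

lemma finExt_le {P R : ObjectProperty C} [R.IsClosedUnderIsomorphisms]
    (zero : ∀ Z, IsZero Z → R Z)
    (ext : ∀ {A E X : C} {f : A ⟶ E} {g : E ⟶ X} {w : f ≫ g = 0},
      (ShortComplex.mk f g w).ShortExact → R A → P.isoClosure X → R E) : finExt P ≤ R := by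
  rintro M ⟨J, i₁, i₂, i₃, i₄, i₅, h⟩
  refine filtration_induction zero ext (fun F _ m hm _ ↦ ?_) h
  -- A finite order has no limit elements: `m` covers a maximal element below it.
  obtain ⟨a, ha, ha'⟩ := (Set.toFinite (Set.Iio m)).exists_maximal ⟨⊥, hm.bot_lt⟩
  refine absurd ?_ (hm.isSuccPrelimit a)
  exact ⟨ha, fun b hab hbm ↦ hab.not_ge (ha' hbm hab.le)⟩

lemma filt_le {P R : ObjectProperty C} [R.IsClosedUnderIsomorphisms]
    (zero : ∀ Z, IsZero Z → R Z)
    (ext : ∀ {A E X : C} {f : A ⟶ E} {g : E ⟶ X} {w : f ≫ g = 0},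
      (ShortComplex.mk f g w).ShortExact → R A → P.isoClosure X → R E)
    (lim : dirLim R ≤ R) : Filt P ≤ R := by
  rintro M ⟨J, i₁, i₂, i₃, i₄, i₅, h⟩
  refine filtration_induction zero ext (fun F _ m hm hR ↦ ?_) h
  have : Nonempty (Set.Iio m) := ⟨⟨⊥, hm.bot_lt⟩⟩
  exact lim _ ⟨Set.Iio m, inferInstance, inferInstance,
    ⟨_, _, F.isColimitOfIsWellOrderContinuous m hm⟩, fun j ↦ hR j.1 j.2⟩

end Induction

section DirLim

variable {Q : Type v} [Quiver.{v} Q] {A : Type u} [Category.{v} A] [HasColimits A] [Abelian A]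
  [AB5 A]

lemma FPTwo.freeAt {X : A} (hX : FPTwo X) (x : Q) : FPTwo ((freeAt x).obj X) :=
  FPTwo.leftAdjoint_obj (freeAdj x) hX

lemma finExt_fStar_le_isFinitelyPresentable {X : ObjectProperty A} (hX : ∀ Y, X Y → FPTwo Y) :
    finExt (fStar X) ≤ ObjectProperty.isFinitelyPresentable.{v} (Rep Q A) := by
  have : (ObjectProperty.isFinitelyPresentable.{v} (Rep Q A)).IsClosedUnderIsomorphisms := by
    have := Cardinal.fact_isRegular_aleph0.{v}
    exact inferInstanceAs (isCardinalPresentable (Rep Q A) Cardinal.aleph0).IsClosedUnderIsomorphisms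
  refine finExt_le (fun Z hZ ↦ ?_) (fun {E F G f g w} h hE hG ↦ ?_)
  · exact isFinitelyPresentable_of_exists
      (fun {J _ _ D c} hc f ↦ ⟨(IsFiltered.nonempty (C := J)).some, 0, hZ.eq_of_src _ _⟩)
      (fun {J _ _ D c} hc j p hp ↦ ⟨j, 𝟙 j, hZ.eq_of_src _ _⟩)
  · obtain ⟨_, ⟨x, Y, hY, ⟨e'⟩⟩, ⟨e⟩⟩ := hG
    let e'' := e ≪≫ e'
    have h' : (ShortComplex.mk f (g ≫ e''.hom) (by rw [reassoc_of% w, zero_comp])).ShortExact :=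
      ShortComplex.shortExact_of_iso
        (ShortComplex.isoMk (S₁ := .mk f g w) (Iso.refl _) (Iso.refl _) e'' (by simp) (by simp)) h
    exact isFinitelyPresentable_of_shortExact h' hE ((hX _ hY).freeAt x)

lemma dirLim_finExt_of_shortExact {X : ObjectProperty A} (hX : ∀ Y, X Y → FPTwo Y)
    {F G H : Rep Q A} {f : F ⟶ G} {g : G ⟶ H} {w : f ≫ g = 0}
    (h : (ShortComplex.mk f g w).ShortExact) (hF : dirLim (finExt (fStar X)) F)
    (hH : (fStar (dirLim X)).isoClosure H) : dirLim (finExt (fStar X)) G := by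
  -- Equality instead of isomorphism avoids transporting `FPTwo`; `f_x` preserves the colimits
  -- presenting objects of `lim X`.
  let T : ObjectProperty (Rep Q A) := fun F ↦ ∃ x Y, X Y ∧ F = (freeAt x).obj Y
  have hT : dirLim T H := by
    obtain ⟨_, ⟨x, Y, ⟨J, i₁, i₂, p, hp⟩, ⟨e'⟩⟩, ⟨e⟩⟩ := hH
    have : (freeAt (A := A) x).IsLeftAdjoint := ⟨_, ⟨freeAdj x⟩⟩
    exact ⟨J, i₁, i₂, (p.map (freeAt x)).ofIso (e ≪≫ e').symm, fun j ↦ ⟨x, _, hp j, rfl⟩⟩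
  refine dirLim_of_shortExact (P := finExt (fStar X)) h
    (finExt_fStar_le_isFinitelyPresentable hX) ?_ (fun h hA hZ ↦ ?_) hF hT
  · rintro _ ⟨x, Y, hY, rfl⟩
    exact (hX _ hY).freeAt x
  · obtain ⟨x, Y, hY, rfl⟩ := hZ
    exact finExt_of_shortExact _ h hA (le_finExt _ _ (fStar_freeAt x hY))

/-- The target contains zero, is closed under extensions by `f_*(lim X)`, and under direct limits
since `ext f_*(X)` is finitely presentable; so it contains all `f_*(lim X)`-filtered objects. -/
lemma phi_dirLim_le (hQ : IsLeftRooted Q) {X : ObjectProperty A} (hX : ∀ Y, X Y → FPTwo Y) :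
    (Phi (dirLim X) : ObjectProperty (Rep Q A)) ≤ dirLim (finExt (fStar X)) := by
  have : (dirLim (finExt (fStar X) : ObjectProperty (Rep Q A))).IsClosedUnderIsomorphisms :=
    inferInstanceAs (ObjectProperty.ind _).IsClosedUnderIsomorphisms
  refine (phi_le_filt hQ _).trans (filt_le (fun Z hZ ↦ ?_)
    (fun h ↦ dirLim_finExt_of_shortExact hX h) ?_)
  · exact ObjectProperty.le_ind _ _ (finExt_of_isZero _ hZ)
  · exact (ObjectProperty.ind_ind (finExt_fStar_le_isFinitelyPresentable hX)).le

/-- Filtered colimits preserve monomorphisms and commute with `φ_x` and its cokernel. -/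
lemma dirLim_phi_le (X : ObjectProperty A) :
    dirLim (Phi X : ObjectProperty (Rep Q A)) ≤ Phi (dirLim X) := by
  rintro F ⟨J, i₁, i₂, p, hp⟩ x
  refine ⟨mono_phiMap_of_isColimit p.isColimit x fun j ↦ (hp j x).1,
    ObjectProperty.le_isoClosure _ _ ?_⟩
  rw [← dirLim_isoClosure]
  exact ⟨J, i₁, i₂, p.map (cok x), fun j ↦ (hp j x).2⟩

lemma phi_isZero {X : ObjectProperty A} (hX : X.ContainsZero) {F : Rep Q A} (hF : IsZero F) :
    Phi X F := by
  intro x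
  have : IsZero ((inc x).obj F) := (inc x).map_isZero hF
  obtain ⟨Z, hZ, hZ'⟩ := hX
  exact ⟨Preadditive.mono_of_cancel_zero _ (fun _ _ ↦ this.eq_of_tgt _ _),
    ⟨Z, hZ', ⟨((cok x).map_isZero hF).iso hZ⟩⟩⟩

/-- An isomorphism is a short exact sequence with zero quotient. -/
lemma isClosedUnderIsomorphisms_of_extensions {C : Type u} [Category.{v} C] [Abelian C]
    {X : ObjectProperty C} (h₀ : X.ContainsZero) (h : X.IsClosedUnderExtensions) :
    X.IsClosedUnderIsomorphisms where
  of_iso {Y Y'} e hY := by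
    obtain ⟨Z, hZ, hZ'⟩ := h₀
    have hS : (ShortComplex.mk e.hom (0 : Y' ⟶ Z) comp_zero).ShortExact := by
      have : Epi (0 : Y' ⟶ Z) := ⟨fun _ _ _ ↦ hZ.eq_of_src _ _⟩
      exact shortExact_of_fac _ _ _ (fun T t _ ↦ ⟨t ≫ e.inv, by simp⟩)
    exact X.prop_X₂_of_shortExact hS hY hZ'

lemma phi_of_shortExact {X : ObjectProperty A} [X.IsClosedUnderIsomorphisms]
    (hX : X.IsClosedUnderExtensions) {S : ShortComplex (Rep Q A)} (hS : S.ShortExact)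
    (h₁ : Phi X S.X₁) (h₃ : Phi X S.X₃) : Phi X S.X₂ := by
  intro x
  have : Mono (phiMap S.X₁ x) := (h₁ x).1
  have : Mono (phiMap S.X₃ x) := (h₃ x).1
  have := hS.epi_g
  have := mono_cok_map hS x
  have h₁' := (h₁ x).2
  have h₃' := (h₃ x).2
  rw [ObjectProperty.isoClosure_eq_self] at h₁' h₃' ⊢
  have : (S.map (cok x)).ShortExact := ShortComplex.ShortExact.mk'
    (hS.exact.map_of_epi_of_preservesCokernel (cok x) inferInstance inferInstance)
    (mono_cok_map hS x) (inferInstanceAs (Epi ((cok x).map S.g)))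
  exact ⟨mono_phi_of_shortExact hS x, X.prop_X₂_of_shortExact this h₁' h₃'⟩

lemma finExt_fStar_le_phi {X : ObjectProperty A} (h₀ : X.ContainsZero)
    (hX : X.IsClosedUnderExtensions) : (finExt (fStar X) : ObjectProperty (Rep Q A)) ≤ Phi X := by
  have := isClosedUnderIsomorphisms_of_extensions h₀ hX
  refine finExt_le (fun Z hZ ↦ phi_isZero h₀ hZ) (fun h hA hX' ↦ phi_of_shortExact hX h hA ?_)
  obtain ⟨_, hY, ⟨e⟩⟩ := hX'
  exact ObjectProperty.prop_of_iso _ e.symm (fStar_le_phi h₀ _ hY)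

end DirLim

end QuiverRep

end

/-! ### The main theorem. -/

open QuiverRep in
theorem theoremA {A : Type u} [Category.{v} A] [Abelian A] [HasColimits A] [AB5 A]
    {Q : Type v} [Quiver.{v} Q] (hQ : IsLeftRooted Q) (X : ObjectProperty A) :
    -- every object of `Φ(X)` is filtered by direct sums of objects of `f_*(X)`
    ((Phi X : ObjectProperty (Rep Q A)) ≤ Filt (sums (fStar X))) ∧
    -- `X` closed under filtrations
    (Filt X ≤ X → (Phi X : ObjectProperty (Rep Q A)) = Filt (sums (fStar X))) ∧
    -- `X` a set: filtered objects
    (ObjectProperty.EssentiallySmall.{v} X →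
      (Phi (Filt X) : ObjectProperty (Rep Q A)) = Filt (fStar X) ∧
      (Filt (Phi X) : ObjectProperty (Rep Q A)) ≤ Filt (fStar X) ∧
      (X.ContainsZero → (Filt (fStar X) : ObjectProperty (Rep Q A)) = Filt (Phi X))) ∧
    -- `X` a set: direct summands of filtered objects
    (ObjectProperty.EssentiallySmall.{v} X →
      (Phi (sFilt X) : ObjectProperty (Rep Q A)) = sFilt (fStar X) ∧
      (sFilt (fStar X) : ObjectProperty (Rep Q A)) = sFilt (Phi X)) ∧
    -- direct limits
    (IsLocallyFinitelyPresentable.{v} A → X ≤ FPHalf 2 →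
      (dirLim (Phi X) : ObjectProperty (Rep Q A)) ≤ Phi (dirLim X) ∧
      (Phi (dirLim X) : ObjectProperty (Rep Q A)) ≤ dirLim (finExt (fStar X)) ∧
      (X.ContainsZero → X.IsClosedUnderExtensions →
        (Phi (dirLim X) : ObjectProperty (Rep Q A)) = dirLim (finExt (fStar X)) ∧
        (dirLim (finExt (fStar X)) : ObjectProperty (Rep Q A)) = dirLim (Phi X))) := by
  refine ⟨(phi_le_filt hQ X).trans (Filt.mono (le_sums _)), phi_eq_filt_sums hQ, fun _ ↦ ?_,
    fun _ ↦ ⟨phi_sFilt hQ X, sFilt_fStar hQ X⟩, fun _ hX ↦ ?_⟩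
  · have h := phi_filt hQ X
    have h' := h ▸ filt_phi_le X
    exact ⟨h, h', fun h₀ ↦ le_antisymm (Filt.mono (fStar_le_phi h₀)) h'⟩
  -- Injectives are needed to realize `Ext^1`-classes by extensions.
  · have := enoughInjectives_of_isLocallyFinitelyPresentable A
    have hX' (Y : A) (hY : X Y) : FPTwo Y := FPTwo.of_FP (hX Y hY).1
    have h₁ := dirLim_phi_le (Q := Q) X
    have h₂ := phi_dirLim_le hQ hX'
    refine ⟨h₁, h₂, fun h₀ hE ↦ ?_⟩
    have h₃ := dirLim_mono (finExt_fStar_le_phi (Q := Q) h₀ hE)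
    exact ⟨le_antisymm h₂ (h₃.trans h₁), le_antisymm h₃ (h₁.trans h₂)⟩
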